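/- Let $G=(V,E)$ be a simple graph with $V$ an arbitrary, possibly infinite, set and $E\subseteq[V]^2$. Let $|G|$ be its one-complex: the quotient of the topological sum of the discrete space $V$ and one copy $[0,1]_e$ of the unit interval for every edge $e\in E$, where for each edge $e=\{v,w\}$ the point $0\in[0,1]_e$ is identified with $v$ and the point $1\in[0,1]_e$ with $w$. An arc in a space is a subspace homeomorphic to $[0,1]$. The graph $G$ is called $5$-ac if for any choice of at most five points of $|G|$ there is an arc in $|G|$ containing them, and $G$ is called cyclically connected if every two distinct vertices of $G$ lie on a common cycle of $G$. Theorem. Let $G$ be a graph that is not cyclically connected. Then $G$ is $5$-ac if and only if $|G|$ is homeomorphic to one of the following spaces: (a) an arc $[0,1]$, a ray $[0,\infty)$, or a double ray $\mathbb{R}$; (b) a lollipop (a circle together with an arc that meets the circle in exactly one of the endpoints of the arc), or a lollipop without its endpoint (the same space with the other endpoint of the arc removed); (c) the dumbbell (two disjoint circles together with an arc that has one endpoint on each circle and is otherwise disjoint from both); (d) the figure-of-eight (two circles with exactly one point in common). -/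

import Mathlib

namespace ArcGraph

/-- The disjoint sum of the vertex set and one copy of `[0,1]` for every edge, before gluing. -/
abbrev PreComplex {V : Type*} (G : SimpleGraph V) : Type _ :=
  V ⊕ (Σ _ : G.edgeSet, unitInterval)

/-- The gluing relation of the one-complex. For an edge `e = {v, w}`, with its ends listed as
`(v, w) = Quot.out e` (the order is immaterial), the point `0` of `[0,1]_e` is identified with `v`
and the point `1` with `w`. -/
inductive Glue {V : Type*} (G : SimpleGraph V) : PreComplex G → PreComplex G → Prop
  | source (e : G.edgeSet) : Glue G (Sum.inl (Quot.out e.1).1) (Sum.inr ⟨e, 0⟩)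
  | target (e : G.edgeSet) : Glue G (Sum.inl (Quot.out e.1).2) (Sum.inr ⟨e, 1⟩)

/-- The underlying set of the one-complex `|G|` of a graph `G`. -/
def Complex {V : Type*} (G : SimpleGraph V) : Type _ :=
  Quot (Glue G)

/-- `|G|` carries the quotient topology, where the vertex set is discrete. -/
instance instTopologicalSpaceComplex {V : Type*} (G : SimpleGraph V) :
    TopologicalSpace (Complex G) :=
  letI : TopologicalSpace V := ⊥
  inferInstanceAs (TopologicalSpace (Quot (Glue G)))

/-- An arc in a space: a subset homeomorphic to the closed unit interval. -/
def IsArc {X : Type*} [TopologicalSpace X] (A : Set X) : Prop :=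
  Nonempty (unitInterval ≃ₜ A)

/-- `X` is `n`-arc connected: any at most `n` points of `X` lie on an arc in `X`. -/
def IsArcConnected (n : ℕ) (X : Type*) [TopologicalSpace X] : Prop :=
  ∀ S : Finset X, S.card ≤ n → ∃ A : Set X, IsArc A ∧ (S : Set X) ⊆ A

/-- A graph is cyclically connected if every two (distinct) vertices lie on a cycle. -/
def CyclicallyConnected {V : Type*} (G : SimpleGraph V) : Prop :=
  ∀ u v : V, u ≠ v → ∃ (w : V) (c : G.Walk w w), c.IsCycle ∧ u ∈ c.support ∧ v ∈ c.support

/-- The lollipop: a circle with an arc attached to it at one of the ends of the arc. -/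
def lollipop : Set ℂ := Metric.sphere 0 1 ∪ segment ℝ 1 2

/-- The lollipop without its endpoint (the free end of the attached arc). -/
def openLollipop : Set ℂ := lollipop \ {2}

/-- The dumbbell: two disjoint circles joined by an arc. -/
def dumbbell : Set ℂ := Metric.sphere (-2) 1 ∪ segment ℝ (-1) 1 ∪ Metric.sphere 2 1

/-- The figure-of-eight: two circles with exactly one common point. -/
def figureEight : Set ℂ := Metric.sphere (-1) 1 ∪ Metric.sphere 1 1

end ArcGraph

/-! A graph that is `5`-ac is connected, and if it has at most two vertices it is a single edge.
Otherwise, since it is not cyclically connected, Whitney's theorem (`cyclicallyConnected_of_no_cut`)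
gives a cut vertex `w`, and `G` is a union of two graphs with at least one edge each that meet only
in `w` (`exists_split`).

Choose the midpoints of four edges on one side and of one edge on the other. An arc through them
traces a walk whose inner vertices are distinct (`exists_innerPath_of_isArcConnected`). This walk
changes sides, so it passes through `w`; cut there, it leaves on each side a walk from `w` that
repeats no vertex before its last one, and one of the two carries all four edges
(`IsSplit.fourEdgeRho`).

Such a rooted side is a ray, a path, or a lasso, that is, a possibly trivial path from `w` ending on
a cycle (`FourEdgeRho.classify`). Four edges suffice: the two cycle edges at the end of the stem
force the covering walk to close up there, and two more edges at a cycle vertex would give that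
vertex degree three on the walk. The two sides combine to the listed spaces; two lassos give the
figure-of-eight if both stems are trivial and the dumbbell otherwise.

The homeomorphisms come from presenting `|G|` and the planar model as quotients of the same real
interval with the same identifications (`IsSplit.exists_isQuotientMap`,
`IsGluing.exists_isQuotientMap`, `nonempty_homeomorph_of_isQuotientMap`).

Conversely, each listed space is a continuous bijective image of a real interval, so finitely many
points lie on the image of a compact subinterval, which is an arc. Hence the listed spaces are
`n`-ac for every `n`. -/

namespace ArcGraph

open Set Topology

/-! ### Topology of the one-complex -/

section Complex

variable {V : Type*} {G : SimpleGraph V}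

/-- The point of `|G|` given by a vertex. -/
def vtx (G : SimpleGraph V) (v : V) : Complex G := Quot.mk _ (Sum.inl v)

/-- The characteristic map of an edge. -/
def edgeMap (e : G.edgeSet) (s : unitInterval) : Complex G := Quot.mk _ (Sum.inr ⟨e, s⟩)

theorem edgeMap_zero (e : G.edgeSet) : edgeMap e 0 = vtx G (Quot.out e.1).1 :=
  (Quot.sound (Glue.source e)).symm

theorem edgeMap_one (e : G.edgeSet) : edgeMap e 1 = vtx G (Quot.out e.1).2 :=
  (Quot.sound (Glue.target e)).symm

/-- The vertex set is discrete and so imposes no condition: the topology is tested on edges alone.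
-/
theorem isOpen_complex_iff {U : Set (Complex G)} :
    IsOpen U ↔ ∀ e : G.edgeSet, IsOpen (edgeMap e ⁻¹' U) := by
  let _ : TopologicalSpace V := ⊥
  have : DiscreteTopology V := ⟨rfl⟩
  have h : IsOpen U ↔ IsOpen (Quot.mk (Glue G) ⁻¹' U) :=
    (isQuotientMap_quot_mk (r := Glue G)).isOpen_preimage.symm
  rw [h, isOpen_sum_iff, isOpen_sigma_iff]
  exact ⟨fun h => h.2, fun h => ⟨isOpen_discrete _, h⟩⟩

theorem continuous_edgeMap (e : G.edgeSet) : Continuous (edgeMap e) :=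
  ⟨fun _ hU => isOpen_complex_iff.1 hU e⟩

theorem isClosed_complex_iff {C : Set (Complex G)} :
    IsClosed C ↔ ∀ e : G.edgeSet, IsClosed (edgeMap e ⁻¹' C) := by
  simp only [← isOpen_compl_iff, isOpen_complex_iff, preimage_compl]

theorem continuous_complex_iff {X : Type*} [TopologicalSpace X] {f : Complex G → X} :
    Continuous f ↔ ∀ e : G.edgeSet, Continuous (f ∘ edgeMap e) := by
  refine ⟨fun h e => h.comp (continuous_edgeMap e), fun h => ⟨fun U hU => ?_⟩⟩
  exact isOpen_complex_iff.2 fun e => hU.preimage (h e)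

/-- A map out of `|G|` given on the vertices and on the edges. -/
def Complex.lift {X : Type*} (f : V → X) (g : G.edgeSet → unitInterval → X)
    (h0 : ∀ e, g e 0 = f (Quot.out e.1).1) (h1 : ∀ e, g e 1 = f (Quot.out e.1).2) :
    Complex G → X :=
  Quot.lift (Sum.elim f fun p => g p.1 p.2) (by
    rintro _ _ (e | e)
    · exact (h0 e).symm
    · exact (h1 e).symm)

theorem exists_vtx_or_edgeMap (p : Complex G) :
    (∃ v, p = vtx G v) ∨ ∃ (e : G.edgeSet) (s : unitInterval), 0 < s ∧ s < 1 ∧ p = edgeMap e s := by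
  induction p using Quot.ind with
  | mk a =>
    rcases a with v | ⟨e, s⟩
    · exact Or.inl ⟨v, rfl⟩
    · rcases eq_or_ne s 0 with rfl | h0
      · exact Or.inl ⟨_, edgeMap_zero e⟩
      rcases eq_or_ne s 1 with rfl | h1
      · exact Or.inl ⟨_, edgeMap_one e⟩
      exact Or.inr ⟨e, s, unitInterval.pos_iff_ne_zero.2 h0, unitInterval.lt_one_iff_ne_one.2 h1, rfl⟩

theorem out_adj (e : G.edgeSet) : G.Adj (Quot.out e.1).1 (Quot.out e.1).2 := by
  have h : s((Quot.out e.1).1, (Quot.out e.1).2) = e.1 := Quot.out_eq e.1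
  rw [← SimpleGraph.mem_edgeSet, h]
  exact e.2

theorem mk_out (e : G.edgeSet) : s((Quot.out e.1).1, (Quot.out e.1).2) = e.1 :=
  Quot.out_eq e.1

open Classical in
/-- The piecewise linear function that is `1` at `v` and `0` at all other vertices. -/
noncomputable def hat (G : SimpleGraph V) (v : V) : Complex G → ℝ :=
  Complex.lift (fun x => if x = v then 1 else 0)
    (fun e s => (1 - (s : ℝ)) * (if (Quot.out e.1).1 = v then 1 else 0) +
      s * (if (Quot.out e.1).2 = v then 1 else 0)) (by simp) (by simp)

open Classical in
/-- A function that is positive exactly in the interior of the edge `e`. -/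
noncomputable def bump (e : G.edgeSet) : Complex G → ℝ :=
  Complex.lift (fun _ => 0) (fun e' s => if e' = e then (s : ℝ) * (1 - s) else 0)
    (by simp) (by simp)

open Classical in
theorem hat_vtx (v x : V) : hat G v (vtx G x) = if x = v then 1 else 0 := rfl

open Classical in
theorem hat_edgeMap (v : V) (e : G.edgeSet) (s : unitInterval) :
    hat G v (edgeMap e s) = (1 - (s : ℝ)) * (if (Quot.out e.1).1 = v then 1 else 0) +
      s * (if (Quot.out e.1).2 = v then 1 else 0) := rfl

theorem bump_vtx (e : G.edgeSet) (x : V) : bump e (vtx G x) = 0 := rfl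

open Classical in
theorem bump_edgeMap (e e' : G.edgeSet) (s : unitInterval) :
    bump e (edgeMap e' s) = if e' = e then (s : ℝ) * (1 - s) else 0 := rfl

theorem continuous_hat (v : V) : Continuous (hat G v) := by
  refine continuous_complex_iff.2 fun e => ?_
  simp only [Function.comp_def, hat_edgeMap]
  fun_prop

theorem continuous_bump (e : G.edgeSet) : Continuous (bump e) := by
  refine continuous_complex_iff.2 fun e' => ?_
  simp only [Function.comp_def, bump_edgeMap]
  split_ifs <;> fun_prop

/-- The equivalence relation generated by `Glue` is never described. Points are told apart by
functions such as `hat` and `bump` that descend to the quotient. -/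
theorem vtx_injective : Function.Injective (vtx G) := by
  intro x y h
  have := congrArg (hat G y) h
  by_contra hne
  simp [hat_vtx, hne] at this

theorem edgeMap_injective (e : G.edgeSet) : Function.Injective (edgeMap e) := by
  intro s t h
  -- Since the two ends of `e` differ, this function takes the value `s` at `edgeMap e s`.
  have := congrArg (hat G (Quot.out e.1).2) h
  simpa [hat_edgeMap, (out_adj e).ne, Subtype.ext_iff] using this

theorem mem_of_hat_ne_zero {v : V} {e : G.edgeSet} {s : unitInterval}
    (h : hat G v (edgeMap e s) ≠ 0) : v ∈ e.1 := by
  rw [← mk_out e, Sym2.mem_iff]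
  by_contra! hc
  simp [hat_edgeMap, hc.1.symm, hc.2.symm] at h

/-- The interior of an edge. -/
def openEdge (e : G.edgeSet) : Set (Complex G) := {p | 0 < bump e p}

theorem isOpen_openEdge (e : G.edgeSet) : IsOpen (openEdge e) :=
  isOpen_lt continuous_const (continuous_bump e)

theorem edgeMap_mem_openEdge {e e' : G.edgeSet} {s : unitInterval} :
    edgeMap e s ∈ openEdge e' ↔ e = e' ∧ 0 < s ∧ s < 1 := by
  simp only [openEdge, mem_ofPred_eq, bump_edgeMap]
  split_ifs with h
  · simp only [h, true_and]
    constructor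
    · intro hs
      refine ⟨unitInterval.pos_iff_ne_zero.2 ?_, unitInterval.lt_one_iff_ne_one.2 ?_⟩ <;>
        rintro rfl <;> simp at hs
    · rintro ⟨h0, h1⟩
      have h0' : (0 : ℝ) < s := h0
      have h1' : (s : ℝ) < 1 := h1
      exact mul_pos h0' (by linarith)
  · simp [h]

theorem vtx_notMem_openEdge (v : V) (e : G.edgeSet) : vtx G v ∉ openEdge e := by
  simp [openEdge, bump_vtx]

theorem mem_openEdge {e : G.edgeSet} {p : Complex G} :
    p ∈ openEdge e ↔ ∃ s : unitInterval, 0 < s ∧ s < 1 ∧ p = edgeMap e s := by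
  constructor
  · intro hp
    rcases exists_vtx_or_edgeMap p with ⟨v, rfl⟩ | ⟨e', s, h0, h1, rfl⟩
    · exact absurd hp (vtx_notMem_openEdge v e)
    · obtain ⟨rfl, -⟩ := edgeMap_mem_openEdge.1 hp
      exact ⟨s, h0, h1, rfl⟩
  · rintro ⟨s, h0, h1, rfl⟩
    exact edgeMap_mem_openEdge.2 ⟨rfl, h0, h1⟩

theorem openEdge_eq_of_mem {e e' : G.edgeSet} {p : Complex G} (h : p ∈ openEdge e)
    (h' : p ∈ openEdge e') : e = e' := by
  obtain ⟨s, -, -, rfl⟩ := mem_openEdge.1 h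
  exact (edgeMap_mem_openEdge.1 h').1

/-- On each edge such a set can occupy only the parameters `0` and `1`. As this applies to every set
of vertices, a compact set can contain only finitely many of them. -/
theorem isClosed_of_subset_vtx {C : Set (Complex G)} (hC : C ⊆ range (vtx G)) : IsClosed C := by
  refine isClosed_complex_iff.2 fun e => Set.Finite.isClosed ?_
  refine (Set.toFinite ({0, 1} : Set unitInterval)).subset fun s hs => ?_
  obtain ⟨v, hv⟩ := hC hs
  by_contra hne
  simp only [mem_insert_iff, mem_singleton_iff, not_or] at hne
  refine vtx_notMem_openEdge v e ?_
  rw [hv, edgeMap_mem_openEdge]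
  exact ⟨rfl, unitInterval.pos_iff_ne_zero.2 hne.1, unitInterval.lt_one_iff_ne_one.2 hne.2⟩

/-- A connected set of points of `|G|` that contains no vertex lies in the interior of an edge. -/
theorem exists_subset_openEdge {S : Set (Complex G)} (hS : IsPreconnected S) (hne : S.Nonempty)
    (hv : ∀ v, vtx G v ∉ S) : ∃ e : G.edgeSet, S ⊆ openEdge e := by
  have key : ∀ p ∈ S, ∃ e : G.edgeSet, p ∈ openEdge e := by
    intro p hp
    rcases exists_vtx_or_edgeMap p with ⟨v, rfl⟩ | ⟨e, s, h0, h1, rfl⟩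
    · exact absurd hp (hv v)
    · exact ⟨e, edgeMap_mem_openEdge.2 ⟨rfl, h0, h1⟩⟩
  obtain ⟨p, hp⟩ := hne
  obtain ⟨e, he⟩ := key p hp
  refine ⟨e, hS.subset_left_of_subset_union (isOpen_openEdge e)
    (v := ⋃ e' : {e' : G.edgeSet // e' ≠ e}, openEdge e'.1)
    (isOpen_iUnion fun _ => isOpen_openEdge _) ?_ ?_ ⟨p, hp, he⟩⟩
  · rw [Set.disjoint_left]
    rintro q hq hq'
    obtain ⟨e', he'⟩ := mem_iUnion.1 hq'
    exact e'.2 (openEdge_eq_of_mem he' hq)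
  · intro q hq
    obtain ⟨e', he'⟩ := key q hq
    by_cases h : e' = e
    · exact Or.inl (h ▸ he')
    · exact Or.inr (mem_iUnion.2 ⟨⟨e', h⟩, he'⟩)

/-- A vertex in the closure of the interior of an edge is an end of that edge. -/
theorem mem_of_vtx_mem_closure {v : V} {e : G.edgeSet} (h : vtx G v ∈ closure (openEdge e)) :
    v ∈ e.1 := by
  obtain ⟨p, hp, hpe⟩ := mem_closure_iff.1 h {p | 0 < hat G v p}
    (isOpen_lt continuous_const (continuous_hat v)) (by simp [hat_vtx])
  obtain ⟨s, -, -, rfl⟩ := mem_openEdge.1 hpe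
  exact mem_of_hat_ne_zero (ne_of_gt hp)

/-- Parametrization of the edge from `a` to `b`, in this direction. -/
theorem exists_edge_param {a b : V} (h : G.Adj a b) :
    ∃ f : ℝ → Complex G, Continuous f ∧ f 0 = vtx G a ∧ f 1 = vtx G b ∧
      InjOn f (Icc 0 1) ∧ (∀ t ∈ Ioo (0 : ℝ) 1, f t ∈ openEdge ⟨s(a, b), h⟩) ∧
      ∃ r : unitInterval → unitInterval, Continuous r ∧
        ∀ s, edgeMap ⟨s(a, b), h⟩ s = f (r s) := by
  set e : G.edgeSet := ⟨s(a, b), h⟩ with he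
  have hor : ((Quot.out e.1).1 = a ∧ (Quot.out e.1).2 = b) ∨
      ((Quot.out e.1).1 = b ∧ (Quot.out e.1).2 = a) := by
    have := mk_out e
    rw [he, Sym2.eq_iff] at this
    exact this
  have hproj : ∀ t ∈ Ioo (0 : ℝ) 1, 0 < projIcc (0 : ℝ) 1 zero_le_one t ∧
      projIcc (0 : ℝ) 1 zero_le_one t < 1 := by
    intro t ht
    rw [projIcc_of_mem zero_le_one (Ioo_subset_Icc_self ht)]
    exact ⟨ht.1, ht.2⟩
  -- `Quot.out` may list the ends in either order; in the second case the edge is run backwards.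
  rcases hor with ⟨h1, h2⟩ | ⟨h1, h2⟩
  · refine ⟨fun t => edgeMap e (projIcc 0 1 zero_le_one t),
      (continuous_edgeMap e).comp continuous_projIcc, ?_, ?_, ?_, ?_, id, continuous_id, ?_⟩
    · simp only [projIcc_left]; rw [← h1]; exact edgeMap_zero e
    · simp only [projIcc_right]; rw [← h2]; exact edgeMap_one e
    · exact (edgeMap_injective e).comp_injOn ((strictMonoOn_projIcc zero_le_one).injOn)
    · intro t ht
      exact edgeMap_mem_openEdge.2 ⟨rfl, hproj t ht⟩
    · intro s; simp
  · refine ⟨fun t => edgeMap e (unitInterval.symm (projIcc 0 1 zero_le_one t)),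
      (continuous_edgeMap e).comp (unitInterval.continuous_symm.comp continuous_projIcc),
      ?_, ?_, ?_, ?_, unitInterval.symm, unitInterval.continuous_symm, ?_⟩
    · simp only [projIcc_left]; rw [← h2]
      exact (congrArg _ unitInterval.symm_zero).trans (edgeMap_one e)
    · simp only [projIcc_right]; rw [← h1]
      exact (congrArg _ unitInterval.symm_one).trans (edgeMap_zero e)
    · exact ((edgeMap_injective e).comp unitInterval.symm_bijective.1).comp_injOn (strictMonoOn_projIcc zero_le_one).injOn
    · intro t ht
      refine edgeMap_mem_openEdge.2 ⟨rfl, ?_, ?_⟩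
      · rw [unitInterval.pos_iff_ne_zero, ne_eq, unitInterval.symm_eq_zero]
        exact (hproj t ht).2.ne
      · rw [unitInterval.lt_one_iff_ne_one, ne_eq, unitInterval.symm_eq_one]
        exact (hproj t ht).1.ne'
    · intro s; simp

end Complex

/-! ### From arcs to vertex sequences -/

section Arcs

variable {V : Type*} {G : SimpleGraph V}

/-- The edges of the sequence `x 0, …, x N`. -/
def seqEdges (x : ℕ → V) (N : ℕ) : Set (Sym2 V) := {e | ∃ i < N, e = s(x i, x (i + 1))}

/-- A walk `x 0, …, x N` whose vertices other than its first and last are distinct. -/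
structure IsInnerPath (G : SimpleGraph V) (x : ℕ → V) (N : ℕ) : Prop where
  adj : ∀ i < N, G.Adj (x i) (x (i + 1))
  inj : ∀ i j, 0 < i → i < N → 0 < j → j < N → x i = x j → i = j

theorem exists_strictMonoOn_enum {α : Type*} [LinearOrder α] [Nonempty α] {T : Set α}
    (hT : T.Finite) : ∃ (m : ℕ) (τ : ℕ → α), StrictMonoOn τ (Iio m) ∧
      ∀ t, t ∈ T ↔ ∃ i < m, t = τ i := by
  classical
  refine ⟨hT.toFinset.card, fun i => if h : i < hT.toFinset.card then
    hT.toFinset.orderEmbOfFin rfl ⟨i, h⟩ else Classical.arbitrary α, ?_, fun t => ?_⟩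
  · intro i hi j hj hij
    simp only [mem_Iio] at hi hj
    simp only [hi, hj, dif_pos]
    exact (hT.toFinset.orderEmbOfFin rfl).strictMono hij
  · have h : t ∈ range (hT.toFinset.orderEmbOfFin rfl) ↔ t ∈ T := by
      rw [Finset.range_orderEmbOfFin]; simp
    rw [← h]
    constructor
    · rintro ⟨⟨i, hi⟩, rfl⟩
      exact ⟨i, hi, by simp [hi]⟩
    · rintro ⟨i, hi, rfl⟩
      exact ⟨⟨i, hi⟩, by simp [hi]⟩

variable {α : unitInterval → Complex G}

/-- All subsets of this set of times are closed, so it is compact and discrete. -/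
theorem finite_vtx_preimage (hc : Continuous α) (hi : Function.Injective α) :
    {t | ∃ v, α t = vtx G v}.Finite := by
  set T := {t | ∃ v, α t = vtx G v} with hT
  have hcl : ∀ T' ⊆ T, IsClosed T' := by
    intro T' hT'
    have : IsClosed (α '' T') := by
      refine isClosed_of_subset_vtx ?_
      rintro _ ⟨t, ht, rfl⟩
      obtain ⟨v, hv⟩ := hT' ht
      exact ⟨v, hv.symm⟩
    rw [← preimage_image_eq T' hi]
    exact this.preimage hc
  have hTc : IsCompact T := (hcl T Subset.rfl).isCompact
  refine hTc.finite ⟨discreteTopology_iff_forall_isClosed.2 fun s => ?_⟩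
  have := (hcl (Subtype.val '' s) (by rintro _ ⟨a, -, rfl⟩; exact a.2)).preimage
    (continuous_subtype_val (p := (· ∈ T)))
  rwa [preimage_image_eq s Subtype.val_injective] at this

/-- Between vertices an arc stays inside one edge, and any vertex it reaches at the border of the
gap is an end of that edge. -/
theorem exists_edge_of_gap (hc : Continuous α) {S : Set unitInterval} (hS : IsPreconnected S)
    (hne : S.Nonempty) (hv : ∀ t ∈ S, ∀ v, α t ≠ vtx G v) :
    ∃ e : G.edgeSet, (∀ t ∈ S, α t ∈ openEdge e) ∧
      ∀ t ∈ closure S, ∀ v, α t = vtx G v → v ∈ e.1 := by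
  obtain ⟨e, he⟩ := exists_subset_openEdge (hS.image α hc.continuousOn) (hne.image α) (by
    rintro v ⟨t, ht, h⟩
    exact hv t ht v h)
  refine ⟨e, fun t ht => he (mem_image_of_mem _ ht), fun t ht v htv => ?_⟩
  refine mem_of_vtx_mem_closure (closure_mono he ?_)
  rw [← htv]
  exact image_closure_subset_closure_image hc (mem_image_of_mem _ ht)

/-- For the pieces of an arc before its first and after its last vertex: the piece is prolonged to
the far end `a` of its edge, or, if empty, by an arbitrary edge. The added vertex may repeat another
one, which is why `IsInnerPath` exempts the two ends. -/
theorem exists_end_of_gap (hiso : ∀ v : V, ∃ u, G.Adj v u) (hc : Continuous α)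
    {S : Set unitInterval} (hS : IsPreconnected S) (hv : ∀ t ∈ S, ∀ v, α t ≠ vtx G v)
    {t₀ : unitInterval} {v : V} (ht₀ : S.Nonempty → t₀ ∈ closure S) (htv : α t₀ = vtx G v) :
    ∃ a, G.Adj v a ∧ ∀ t ∈ S, ∀ e, α t ∈ openEdge e → e.1 = s(v, a) := by
  rcases S.eq_empty_or_nonempty with rfl | hne
  · obtain ⟨a, ha⟩ := hiso v
    exact ⟨a, ha, by simp⟩
  · obtain ⟨e, he, hcl⟩ := exists_edge_of_gap hc hS hne hv
    have hmem := hcl t₀ (ht₀ hne) v htv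
    obtain ⟨a, ha⟩ := Sym2.mem_iff_exists.1 hmem
    refine ⟨a, ?_, fun t ht e' he' => ?_⟩
    · rw [← SimpleGraph.mem_edgeSet, ← ha]; exact e.2
    · rw [← ha, openEdge_eq_of_mem he' (he t ht)]

theorem exists_innerPath_of_injective (hiso : ∀ v : V, ∃ u, G.Adj v u) (hc : Continuous α)
    (hi : Function.Injective α) : ∃ (x : ℕ → V) (N : ℕ), IsInnerPath G x N ∧
      ∀ t, ∀ e : G.edgeSet, α t ∈ openEdge e → e.1 ∈ seqEdges x N := by
  obtain ⟨m, τ, hτ, hT⟩ := exists_strictMonoOn_enum (finite_vtx_preimage hc hi)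
  have hlt : ∀ {i j}, i < m → j < m → (τ i < τ j ↔ i < j) := fun hi hj => hτ.lt_iff_lt hi hj
  -- Beyond `m` the value is arbitrary; some vertex exists because `α (τ i)` is a point of `|G|`.
  have hνex : ∀ i, ∃ v, i < m → α (τ i) = vtx G v := by
    intro i
    by_cases him : i < m
    · obtain ⟨v, hv⟩ := (hT (τ i)).2 ⟨i, him, rfl⟩
      exact ⟨v, fun _ => hv⟩
    · rcases exists_vtx_or_edgeMap (α (τ i)) with ⟨v, -⟩ | ⟨e, -⟩
      · exact ⟨v, fun h => absurd h him⟩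
      · exact ⟨(Quot.out e.1).1, fun h => absurd h him⟩
  choose ν hν using hνex
  have hnot : ∀ t v, α t = vtx G v → ∃ i < m, t = τ i := fun t v h => (hT t).1 ⟨v, h⟩
  -- An arc that meets no vertex lies inside one edge, whose two ends serve as the sequence.
  rcases Nat.eq_zero_or_pos m with rfl | hm
  · obtain ⟨e, he, -⟩ := exists_edge_of_gap (α := α) hc isPreconnected_univ univ_nonempty (by
      intro t _ v h
      obtain ⟨i, hi, -⟩ := hnot t v h
      omega)
    refine ⟨fun i => if i = 0 then (Quot.out e.1).1 else (Quot.out e.1).2, 1,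
      ⟨fun i hi => ?_, by intros; omega⟩, fun t e' h => ⟨0, by omega, ?_⟩⟩
    · obtain rfl : i = 0 := by omega
      simpa using out_adj e
    · rw [openEdge_eq_of_mem h (he t (mem_univ t))]
      simpa using (mk_out e).symm
  have hgap : ∀ i, i + 1 < m → G.Adj (ν i) (ν (i + 1)) ∧ ∀ t ∈ Ioo (τ i) (τ (i + 1)),
      ∀ e : G.edgeSet, α t ∈ openEdge e → e.1 = s(ν i, ν (i + 1)) := by
    intro i him
    have hl : τ i < τ (i + 1) := (hlt (by omega) him).2 (by omega)
    obtain ⟨e, he, hcl⟩ := exists_edge_of_gap hc (isPreconnected_Ioo (a := τ i) (b := τ (i + 1)))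
      (nonempty_Ioo.2 hl) (by
        intro t ht v h
        obtain ⟨j, hj, rfl⟩ := hnot t v h
        have h1 := (hlt (by omega) hj).1 ht.1
        have h2 := (hlt hj him).1 ht.2
        omega)
    rw [closure_Ioo hl.ne] at hcl
    have h1 := hcl (τ i) (left_mem_Icc.2 hl.le) _ (hν i (by omega))
    have h2 := hcl (τ (i + 1)) (right_mem_Icc.2 hl.le) _ (hν (i + 1) him)
    have hne : ν i ≠ ν (i + 1) := by
      intro h
      refine hl.ne (hi ?_)
      rw [hν i (by omega), hν (i + 1) him, h]
    have hes : e.1 = s(ν i, ν (i + 1)) := (Sym2.mem_and_mem_iff hne).1 ⟨h1, h2⟩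
    refine ⟨?_, fun t ht e' he' => ?_⟩
    · rw [← SimpleGraph.mem_edgeSet, ← hes]; exact e.2
    · rw [← hes, openEdge_eq_of_mem he' (he t ht)]
  obtain ⟨l, hl, hle⟩ := exists_end_of_gap hiso hc (S := Iio (τ 0)) isPreconnected_Iio (by
      intro t ht v h
      obtain ⟨j, hj, rfl⟩ := hnot t v h
      have := (hlt hj hm).1 ht
      omega) (fun hne => by
        obtain ⟨a, ha⟩ := hne
        rw [closure_Iio' ⟨a, ha⟩]; exact self_mem_Iic) (hν 0 hm)
  obtain ⟨r, hr, hre⟩ := exists_end_of_gap hiso hc (S := Ioi (τ (m - 1))) isPreconnected_Ioi (by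
      intro t ht v h
      obtain ⟨j, hj, rfl⟩ := hnot t v h
      have := (hlt (by omega) hj).1 ht
      omega) (fun hne => by
        obtain ⟨a, ha⟩ := hne
        rw [closure_Ioi' ⟨a, ha⟩]; exact self_mem_Ici) (hν (m - 1) (by omega))
  -- The vertices met by the arc take the positions `1, …, m`; positions `0` and `m + 1` hold the
  -- added ends.
  set x : ℕ → V := fun i => if i = 0 then l else if i ≤ m then ν (i - 1) else r with hx
  have hx0 : x 0 = l := by simp [hx]
  have hxi : ∀ i, i < m → x (i + 1) = ν i := by
    intro i hi
    simp only [hx]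
    rw [if_neg (by omega), if_pos (by omega), Nat.add_sub_cancel]
  have hxm : x (m + 1) = r := by simp [hx]
  refine ⟨x, m + 1, ⟨?_, ?_⟩, ?_⟩
  · intro i him
    rcases Nat.eq_zero_or_pos i with rfl | h0
    · rw [hx0, hxi 0 hm]; exact hl.symm
    obtain ⟨k, rfl⟩ : ∃ k, i = k + 1 := ⟨i - 1, by omega⟩
    rw [hxi k (by omega)]
    rcases Nat.lt_or_ge (k + 1) m with h | h
    · rw [hxi _ h]; exact (hgap k h).1
    · obtain rfl : m = k + 1 := by omega
      rw [hxm]; exact hr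
  · intro i j hi0 him hj0 hjm hij
    obtain ⟨k, rfl⟩ : ∃ k, i = k + 1 := ⟨i - 1, by omega⟩
    obtain ⟨k', rfl⟩ : ∃ k, j = k + 1 := ⟨j - 1, by omega⟩
    rw [hxi k (by omega), hxi k' (by omega)] at hij
    have := hτ.injOn (x₁ := k) (x₂ := k') (by simp; omega) (by simp; omega) (hi (by
      rw [hν k (by omega), hν k' (by omega), hij]))
    omega
  · intro t e he
    have htT : ∀ i < m, t ≠ τ i := by
      rintro i him rfl
      rw [hν i him] at he
      exact vtx_notMem_openEdge _ _ he
    rcases lt_or_gt_of_ne (htT 0 hm) with h0 | h0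
    · refine ⟨0, by omega, ?_⟩
      rw [hx0, hxi 0 hm, hle t h0 e he, Sym2.eq_swap]
    -- `τ k` is the last vertex time before `t`.
    · set k := Nat.findGreatest (fun i => τ i < t) (m - 1) with hk
      have hkm : k ≤ m - 1 := Nat.findGreatest_le _
      have hkt : τ k < t := Nat.findGreatest_spec (P := fun i => τ i < t) (Nat.zero_le _) h0
      refine ⟨k + 1, by omega, ?_⟩
      rw [hxi k (by omega)]
      rcases Nat.lt_or_ge (k + 1) m with h | h
      · rw [hxi _ h]
        refine (hgap k h).2 t ⟨hkt, ?_⟩ e he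
        refine lt_of_le_of_ne (not_lt.1 ?_) (htT _ h)
        exact Nat.findGreatest_is_greatest (P := fun i => τ i < t) (n := m - 1) (by omega) (by omega)
      · have hkm' : k = m - 1 := by omega
        have : k + 1 + 1 = m + 1 := by omega
        rw [this, hxm, hkm']
        exact hre t (by rw [hkm'] at hkt; exact hkt) e he

/-- Reachability from `u` is constant along edges, so it defines a continuous map from `|G|` to
`Bool`, constant on any arc. -/
theorem preconnected_of_isArcConnected {n : ℕ} (hn : 2 ≤ n) (h : IsArcConnected n (Complex G)) :
    G.Preconnected := by
  classical
  intro u v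
  obtain ⟨A, ⟨φ⟩, hA⟩ := h {vtx G u, vtx G v} (Finset.card_le_two.trans hn)
  have hApre : IsPreconnected A := by
    have := isPreconnected_range (continuous_subtype_val.comp φ.continuous)
    rwa [EquivLike.range_comp, Subtype.range_val] at this
  let f : Complex G → Bool := Complex.lift (fun x => decide (G.Reachable u x))
    (fun e _ => decide (G.Reachable u (Quot.out e.1).1)) (fun e => rfl) (fun e => by
      have := (out_adj e).reachable
      simp only [decide_eq_decide]
      exact ⟨fun h => h.trans this, fun h => h.trans this.symm⟩)
  have hf : Continuous f := continuous_complex_iff.2 fun e =>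
    (continuous_const : Continuous fun _ => decide (G.Reachable u (Quot.out e.1).1))
  have := hApre.constant (f := f) hf.continuousOn (hA (by simp : vtx G u ∈ _))
    (hA (by simp : vtx G v ∈ _))
  have hu : f (vtx G u) = decide (G.Reachable u u) := rfl
  have hv : f (vtx G v) = decide (G.Reachable u v) := rfl
  rw [hu, hv] at this
  simpa using this.symm

/-- The arc is required to contain the midpoints of the given edges. From here on the forward
direction uses arcs only through this combinatorial statement. -/
theorem exists_innerPath_of_isArcConnected {n : ℕ} (h : IsArcConnected n (Complex G))
    (hiso : ∀ v : V, ∃ u, G.Adj v u) (F : Finset (Sym2 V)) (hF : ∀ e ∈ F, e ∈ G.edgeSet)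
    (hn : F.card ≤ n) :
    ∃ (x : ℕ → V) (N : ℕ), IsInnerPath G x N ∧ ∀ e ∈ F, e ∈ seqEdges x N := by
  classical
  have hhalf : (1 / 2 : ℝ) ∈ unitInterval := by constructor <;> norm_num
  let p : {e // e ∈ F} → Complex G := fun e => edgeMap ⟨e.1, hF e.1 e.2⟩ ⟨1 / 2, hhalf⟩
  obtain ⟨A, ⟨φ⟩, hA⟩ := h (F.attach.image p)
    (Finset.card_image_le.trans (by simpa using hn))
  obtain ⟨x, N, hx, hxe⟩ := exists_innerPath_of_injective (α := fun t => (φ t).1) hiso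
    (continuous_subtype_val.comp φ.continuous) (Subtype.val_injective.comp φ.injective)
  refine ⟨x, N, hx, fun e he => ?_⟩
  have hmem : edgeMap ⟨e, hF e he⟩ ⟨1 / 2, hhalf⟩ ∈ A :=
    hA (Finset.mem_coe.2 (Finset.mem_image.2 ⟨⟨e, he⟩, Finset.mem_attach _ _, rfl⟩))
  obtain ⟨t, ht⟩ := φ.surjective ⟨_, hmem⟩
  refine hxe t ⟨e, hF e he⟩ ?_
  rw [ht]
  refine edgeMap_mem_openEdge.2 ⟨rfl, ?_, ?_⟩
  · exact (show (0 : ℝ) < 1 / 2 by norm_num)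
  · exact (show (1 / 2 : ℝ) < 1 by norm_num)

end Arcs

/-! ### Classification of the rooted sides -/

section Rooted

variable {V : Type*} {H : SimpleGraph V} {w : V}

/-- A walk `x 0, …, x N` from `w` whose vertices other than its last one are distinct. -/
structure IsRho (H : SimpleGraph V) (w : V) (x : ℕ → V) (N : ℕ) : Prop where
  zero : x 0 = w
  adj : ∀ i < N, H.Adj (x i) (x (i + 1))
  inj : ∀ i j, i < N → j < N → x i = x j → i = j

/-- Any four edges of `H` lie on a walk from `w` that repeats no vertex before its last one. -/
def FourEdgeRho (H : SimpleGraph V) (w : V) : Prop :=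
  ∀ e₁ ∈ H.edgeSet, ∀ e₂ ∈ H.edgeSet, ∀ e₃ ∈ H.edgeSet, ∀ e₄ ∈ H.edgeSet,
    ∃ y N, IsRho H w y N ∧ e₁ ∈ seqEdges y N ∧ e₂ ∈ seqEdges y N ∧
      e₃ ∈ seqEdges y N ∧ e₄ ∈ seqEdges y N

/-- `H` is the ray `x 0, x 1, …`. -/
structure IsRaySeq (H : SimpleGraph V) (x : ℕ → V) : Prop where
  adj : ∀ i, H.Adj (x i) (x (i + 1))
  inj : Function.Injective x
  edge : ∀ e ∈ H.edgeSet, ∃ i, e = s(x i, x (i + 1))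

/-- `H` is the path `x 0, …, x N`. -/
structure IsPathSeq (H : SimpleGraph V) (x : ℕ → V) (N : ℕ) : Prop where
  adj : ∀ i < N, H.Adj (x i) (x (i + 1))
  inj : ∀ i j, i ≤ N → j ≤ N → x i = x j → i = j
  edge : ∀ e ∈ H.edgeSet, e ∈ seqEdges x N

/-- `H` is the path `x 0, …, x m` together with the cycle `x m, …, x N = x m`. -/
structure IsLassoSeq (H : SimpleGraph V) (x : ℕ → V) (m N : ℕ) : Prop where
  adj : ∀ i < N, H.Adj (x i) (x (i + 1))
  inj : ∀ i j, i < N → j < N → x i = x j → i = j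
  edge : ∀ e ∈ H.edgeSet, e ∈ seqEdges x N
  lt : m + 2 < N
  closed : x N = x m

/-- Every edge lies on a walk from `w`, so a set containing `w` and closed under adjacency accounts
for all edges. Isolated vertices of `H` play no role. -/
theorem FourEdgeRho.edgeSet_subset (hR : FourEdgeRho H w) {S : Set V} {E : Set (Sym2 V)}
    (hw : w ∈ S) (hS : ∀ a ∈ S, ∀ b, H.Adj a b → b ∈ S ∧ s(a, b) ∈ E) : H.edgeSet ⊆ E := by
  intro e he
  obtain ⟨y, N, hy, ⟨i, hi, rfl⟩, -⟩ := hR e he e he e he e he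
  have key : ∀ j ≤ N, y j ∈ S := by
    intro j
    induction j with
    | zero => intro _; rw [hy.zero]; exact hw
    | succ j ih => intro hj; exact (hS _ (ih (by omega)) _ (hy.adj j hj)).1
  exact (hS _ (key i hi.le) _ (hy.adj i hi)).2

/-- The first `n` vertices of `x` have no neighbours off `x`, and `x` does not turn back. -/
structure IsForced (H : SimpleGraph V) (x : ℕ → V) (n : ℕ) : Prop where
  adj : ∀ i < n, H.Adj (x i) (x (i + 1))
  ne : ∀ i < n, x (i + 1) ≠ x (i - 1)
  only : ∀ i < n, ∀ z, H.Adj (x i) z → z = x (i + 1) ∨ z = x (i - 1)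

/-- At a first repetition `x i = x (l + 1)`, the vertex `x l` is a neighbour of `x i`, hence `x (i +
1)` or `x (i - 1)`; this is a turn back or an earlier repetition. As `x (0 - 1)` is `x 0`,
forcedness at `0` means that `x 1` is the only neighbour of the root. -/
theorem IsForced.inj {x : ℕ → V} {n : ℕ} (h : IsForced H x n) {i j : ℕ} (hi : i ≤ n) (hj : j ≤ n)
    (hij : x i = x j) : i = j := by
  have key : ∀ k ≤ n, ∀ i < k, x i ≠ x k := by
    intro k
    induction k using Nat.strong_induction_on with
    | _ k ih =>
      intro hk i hik heq
      obtain ⟨l, rfl⟩ : ∃ l, k = l + 1 := ⟨k - 1, by omega⟩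
      have hadj := h.adj l hk
      rcases eq_or_ne i l with rfl | hil
      · exact hadj.ne heq
      rw [← heq] at hadj
      rcases h.only i (by omega) _ hadj.symm with h1 | h1
      · rcases eq_or_ne (i + 1) l with rfl | h2
        · exact h.ne (i + 1) hk heq.symm
        · exact ih l (by omega) (by omega) (i + 1) (by omega) h1.symm
      · exact ih l (by omega) (by omega) (i - 1) (by omega) h1.symm
  rcases lt_trichotomy i j with h1 | h1 | h1
  · exact absurd hij (key j hj i h1)
  · exact h1
  · exact absurd hij.symm (key i hi j h1)

/-- At a forced vertex the walk can only go on or turn back, and turning back repeats a vertex. The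
last vertex of `y` may be a repetition, hence `j < M`. -/
theorem IsForced.eq_of_isRho {x y : ℕ → V} {n M : ℕ} (h : IsForced H x n) (hx : x 0 = w)
    (hy : IsRho H w y M) {j : ℕ} (hjn : j ≤ n) (hjM : j < M) : y j = x j := by
  induction j using Nat.strong_induction_on with
  | _ j ih =>
    rcases Nat.eq_zero_or_pos j with rfl | h0
    · rw [hx, hy.zero]
    obtain ⟨k, rfl⟩ : ∃ k, j = k + 1 := ⟨j - 1, by omega⟩
    have hk := ih k (by omega) (by omega) (by omega)
    have hadj := hy.adj k (by omega)
    rw [hk] at hadj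
    rcases h.only k (by omega) _ hadj with h1 | h1
    · exact h1
    · rw [← ih (k - 1) (by omega) (by omega) (by omega)] at h1
      have := hy.inj _ _ hjM (by omega) h1
      omega

/-- An edge that leaves the forced part of `x` at its end. -/
theorem IsForced.branch {x y : ℕ → V} {n M : ℕ} (h : IsForced H x n) (hx : x 0 = w)
    (hy : IsRho H w y M) {p : V} (hp : H.Adj (x n) p) (hpn : p ≠ x (n - 1))
    (he : s(x n, p) ∈ seqEdges y M) :
    n < M ∧ (p = y (n + 1) ∨ (y M = x n ∧ p = y (M - 1))) := by
  have hf : ∀ j, j ≤ n → j < M → y j = x j := fun j h1 h2 => h.eq_of_isRho hx hy h1 h2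
  obtain ⟨j, hj, hej⟩ := he
  rcases Sym2.eq_iff.1 hej with ⟨h1, h2⟩ | ⟨h1, h2⟩
  · rcases le_or_gt j n with hjn | hjn
    · rw [hf j hjn hj] at h1
      obtain rfl := h.inj le_rfl hjn h1
      exact ⟨hj, Or.inl h2⟩
    · rw [← hf n le_rfl (by omega)] at h1
      have := hy.inj _ _ (by omega) hj h1
      omega
  · rcases Nat.lt_or_ge (j + 1) M with hjM | hjM
    · rcases le_or_gt (j + 1) n with hjn | hjn
      · rw [hf _ hjn hjM] at h1
        have := h.inj le_rfl hjn h1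
        rw [hf j (by omega) hj] at h2
        exact absurd (by rw [h2, this, Nat.add_sub_cancel]) hpn
      · rw [← hf n le_rfl (by omega)] at h1
        have := hy.inj _ _ (by omega) hjM h1
        omega
    -- Only the last vertex of `y` may repeat, so `y` can return to `x n` only by its final edge.
    · obtain rfl : M = j + 1 := by omega
      rcases Nat.lt_or_ge n (j + 1) with hn | hn
      · exact ⟨hn, Or.inr ⟨h1.symm, h2⟩⟩
      · rw [hf j (by omega) hj] at h2
        rw [h2] at hp
        rcases h.only j (by omega) _ hp.symm with h3 | h3
        · have := h.inj le_rfl (by omega) h3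
          exact absurd (by rw [h2, this, Nat.add_sub_cancel]) hpn
        · have := h.inj le_rfl (by omega) h3
          omega

/-- One of the two edges is used on leaving `x n`, so the other must be the final edge, returning to
`x n`. The cycle formed has length at least three because the two edges are distinct and the graph
is simple. -/
theorem IsForced.closed {x y : ℕ → V} {n M : ℕ} (h : IsForced H x n) (hx : x 0 = w)
    (hy : IsRho H w y M) {p q : V} (hpq : p ≠ q) (hp : H.Adj (x n) p) (hpn : p ≠ x (n - 1))
    (hq : H.Adj (x n) q) (hqn : q ≠ x (n - 1))
    (hep : s(x n, p) ∈ seqEdges y M) (heq : s(x n, q) ∈ seqEdges y M) :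
    n + 2 < M ∧ y M = y n ∧ y n = x n := by
  obtain ⟨hn, h1⟩ := h.branch hx hy hp hpn hep
  obtain ⟨-, h2⟩ := h.branch hx hy hq hqn heq
  have hyn := h.eq_of_isRho hx hy le_rfl hn
  have hM : y M = x n := by
    rcases h1 with h1 | h1
    · rcases h2 with h2 | h2
      · exact absurd (h1.trans h2.symm) hpq
      · exact h2.1
    · exact h1.1
  refine ⟨?_, hM.trans hyn.symm, hyn⟩
  by_contra hlt
  rcases (by omega : M = n + 1 ∨ M = n + 2) with rfl | rfl
  · have := hy.adj n hn
    rw [hM, hyn] at this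
    exact this.ne rfl
  · have e : n + 2 - 1 = n + 1 := by omega
    rw [e] at h1 h2
    exact hpq ((h1.elim id fun h => h.2).trans (h2.elim id fun h => h.2).symm)

section Lasso

variable {u : ℕ → V} {n L : ℕ}

theorem IsRho.lasso_ne (hu : IsRho H w u L) (hn : n + 2 < L) (hL : u L = u n) {k : ℕ}
    (hnk : n < k) (hkL : k < L) : u (k - 1) ≠ u (k + 1) := by
  intro h
  rcases Nat.lt_or_ge (k + 1) L with h1 | h1
  · have := hu.inj _ _ (by omega) h1 h
    omega
  · obtain rfl : L = k + 1 := by omega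
    rw [hL] at h
    have := hu.inj _ _ (by omega) (by omega) h
    omega

/-- Along the lasso, a cycle vertex other than the attaching vertex `u n = u L` is visited once, so
the walk uses only two edges at it. -/
theorem IsRho.lasso_nbr (hu : IsRho H w u L) (hn : n + 2 < L) (hL : u L = u n) {k : ℕ}
    (hnk : n < k) (hkL : k < L) {z : V} (hz : s(u k, z) ∈ seqEdges u L) :
    z = u (k - 1) ∨ z = u (k + 1) := by
  obtain ⟨j, hj, hej⟩ := hz
  rcases Sym2.eq_iff.1 hej with ⟨h1, h2⟩ | ⟨h1, h2⟩
  · obtain rfl := hu.inj _ _ hkL hj h1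
    exact Or.inr h2
  · rcases Nat.lt_or_ge (j + 1) L with h3 | h3
    · obtain rfl := hu.inj _ _ hkL h3 h1
      exact Or.inl h2
    · obtain rfl : L = j + 1 := by omega
      rw [hL] at h1
      have := hu.inj _ _ hkL (by omega) h1
      omega

end Lasso

theorem mem_seqEdges_succ {x : ℕ → V} {N i : ℕ} (h : i < N) : s(x i, x (i + 1)) ∈ seqEdges x N :=
  ⟨i, h, rfl⟩

theorem mem_seqEdges_pred {x : ℕ → V} {N i : ℕ} (h0 : 0 < i) (h : i ≤ N) :
    s(x i, x (i - 1)) ∈ seqEdges x N :=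
  ⟨i - 1, by omega, by rw [Sym2.eq_swap, Nat.sub_add_cancel h0]⟩

/-- It remains to exclude edges off the lasso. The stem is forced, a further edge at `x n` is
excluded by `base`, and one at another cycle vertex by `cyc`. -/
theorem IsForced.isLassoSeq {x : ℕ → V} {n M : ℕ} (hR : FourEdgeRho H w) (hx : IsRho H w x M)
    (h : IsForced H x n) (hn : n + 2 < M) (hM : x M = x n) : IsLassoSeq H x n M := by
  have hadj1 : H.Adj (x n) (x (n + 1)) := hx.adj n (by omega)
  have hadj2 : H.Adj (x n) (x (M - 1)) := by
    have := hx.adj (M - 1) (by omega)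
    rw [Nat.sub_add_cancel (by omega), hM] at this
    exact this.symm
  have hne1 : x (n + 1) ≠ x (n - 1) := fun h => by
    have := hx.inj _ _ (by omega) (by omega) h
    omega
  have hne2 : x (M - 1) ≠ x (n - 1) := fun h => by
    have := hx.inj _ _ (by omega) (by omega) h
    omega
  have hne12 : x (n + 1) ≠ x (M - 1) := fun h => by
    have := hx.inj _ _ (by omega) (by omega) h
    omega
  -- A walk from `w` can use at most two edges at `x n` besides the stem: one to leave and one to
  -- return.
  have base : ∀ z, H.Adj (x n) z → z = x (n - 1) ∨ z = x (n + 1) ∨ z = x (M - 1) := by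
    intro z hz
    by_contra! hc
    obtain ⟨u, L, hu, h1, h2, h3, -⟩ := hR s(x n, x (n + 1)) hadj1 s(x n, x (M - 1)) hadj2
      s(x n, z) hz s(x n, z) hz
    have b1 := (h.branch hx.zero hu hadj1 hne1 h1).2
    have b2 := (h.branch hx.zero hu hadj2 hne2 h2).2
    have b3 := (h.branch hx.zero hu hz hc.1 h3).2
    rcases b1 with b1 | ⟨-, b1⟩ <;> rcases b2 with b2 | ⟨-, b2⟩ <;>
      rcases b3 with b3 | ⟨-, b3⟩ <;> simp_all
  have cyc : ∀ i, n < i → i < M → ∀ z, H.Adj (x i) z → z = x (i - 1) ∨ z = x (i + 1) := by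
    intro i
    induction i using Nat.strong_induction_on with
    | _ i ih =>
      intro hni hiM z hz
      by_contra! hc
      -- The first two edges force `u` to close up at `x n`; the last two are meant to give `x i` a
      -- third edge on `u`.
      obtain ⟨u, L, hu, h1, h2, h3, h4⟩ := hR s(x n, x (n + 1)) hadj1 s(x n, x (M - 1)) hadj2
        s(x i, x (i + 1)) (hx.adj i hiM) s(x i, z) hz
      obtain ⟨hnL, huL, hun⟩ := h.closed hx.zero hu hne12 hadj1 hne1 hadj2 hne2 h1 h2
      -- A cycle vertex of `x` met by `u` is neither on the common stem nor its end, so it lies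
      -- properly inside the cycle of `u`.
      have hfind : ∀ j, n < j → j < M → ∀ a, s(x j, a) ∈ seqEdges u L →
          ∃ k, n < k ∧ k < L ∧ u k = x j := by
        intro j hnj hjM a ha
        obtain ⟨k, hk, hkj⟩ : ∃ k ≤ L, u k = x j := by
          obtain ⟨k, hk, hek⟩ := ha
          rcases Sym2.eq_iff.1 hek with ⟨h5, -⟩ | ⟨h5, -⟩
          · exact ⟨k, hk.le, h5.symm⟩
          · exact ⟨k + 1, hk, h5.symm⟩
        refine ⟨k, ?_, ?_, hkj⟩
        · by_contra hkn
          rw [h.eq_of_isRho hx.zero hu (by omega) (by omega)] at hkj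
          have := hx.inj _ _ (by omega) hjM hkj
          omega
        · refine lt_of_le_of_ne hk ?_
          rintro rfl
          rw [huL, hun] at hkj
          have := hx.inj _ _ (by omega) hjM hkj
          omega
      -- By induction the cycle vertices of `x` before `x i` have degree two, so `u`, having used
      -- the first cycle edge, must follow the cycle as far as `x i`.
      have hchain : ∀ j, n ≤ j → j < i → s(x j, x (j + 1)) ∈ seqEdges u L := by
        intro j hnj
        induction j, hnj using Nat.le_induction with
        | base => exact fun _ => h1
        | succ j hnj ih' =>
          intro hji
          obtain ⟨k, hnk, hkL, hk⟩ := hfind (j + 1) (by omega) (by omega) (x j) (by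
            rw [Sym2.eq_swap]; exact ih' (by omega))
          have e1 : H.Adj (x (j + 1)) (u (k + 1)) := hk ▸ hu.adj k hkL
          have e2 : H.Adj (x (j + 1)) (u (k - 1)) := by
            have := hu.adj (k - 1) (by omega)
            rw [Nat.sub_add_cancel (by omega), hk] at this
            exact this.symm
          have hne := hu.lasso_ne hnL huL hnk hkL
          rcases ih (j + 1) hji (by omega) (by omega) _ e1 with h5 | h5
          · rcases ih (j + 1) hji (by omega) (by omega) _ e2 with h6 | h6
            · exact absurd (h6.trans h5.symm) hne
            · rw [← h6, ← hk]; exact mem_seqEdges_pred (by omega) hkL.le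
          · rw [← h5, ← hk]; exact mem_seqEdges_succ hkL
      obtain ⟨k, hnk, hkL, hk⟩ := hfind i hni hiM z h4
      have hprev := hchain (i - 1) (by omega) (by omega)
      rw [Nat.sub_add_cancel (by omega), Sym2.eq_swap] at hprev
      have hne := hx.lasso_ne hn hM hni hiM
      rw [← hk] at hprev h3 h4
      have b1 := hu.lasso_nbr hnL huL hnk hkL hprev
      have b2 := hu.lasso_nbr hnL huL hnk hkL h3
      have b3 := hu.lasso_nbr hnL huL hnk hkL h4
      rcases b1 with b1 | b1 <;> rcases b2 with b2 | b2 <;> rcases b3 with b3 | b3 <;> simp_all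
  refine ⟨hx.adj, hx.inj, hR.edgeSet_subset (S := {a | ∃ i < M, a = x i})
    ⟨0, by omega, hx.zero.symm⟩ ?_, hn, hM⟩
  rintro _ ⟨i, hi, rfl⟩ b hb
  have hsucc : ∀ i < M, ∃ j < M, x (i + 1) = x j := fun i hi => by
    rcases Nat.lt_or_ge (i + 1) M with h1 | h1
    · exact ⟨i + 1, h1, rfl⟩
    · obtain rfl : M = i + 1 := by omega
      exact ⟨n, by omega, hM⟩
  have hpred : H.Adj (x i) (x (i - 1)) → 0 < i := fun h => by
    rcases Nat.eq_zero_or_pos i with rfl | h0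
    · exact absurd rfl h.ne
    · exact h0
  rcases lt_trichotomy i n with hin | rfl | hin
  · rcases h.only i hin b hb with rfl | rfl
    · exact ⟨hsucc i hi, mem_seqEdges_succ hi⟩
    · exact ⟨⟨i - 1, by omega, rfl⟩, mem_seqEdges_pred (hpred hb) hi.le⟩
  · rcases base b hb with rfl | rfl | rfl
    · exact ⟨⟨i - 1, by omega, rfl⟩, mem_seqEdges_pred (hpred hb) hi.le⟩
    · exact ⟨hsucc i hi, mem_seqEdges_succ hi⟩
    · refine ⟨⟨M - 1, by omega, rfl⟩, ?_⟩
      rw [← hM]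
      exact mem_seqEdges_pred (by omega) le_rfl
  · rcases cyc i hin hi b hb with rfl | rfl
    · exact ⟨⟨i - 1, by omega, rfl⟩, mem_seqEdges_pred (hpred hb) hi.le⟩
    · exact ⟨hsucc i hi, mem_seqEdges_succ hi⟩

/-- The iteration runs on pairs (previous, current), starts at `(w, w)`, and stays put when it
cannot go on without turning back. -/
theorem exists_greedy_seq (H : SimpleGraph V) (w : V) : ∃ x : ℕ → V, x 0 = w ∧
    ∀ n, (∃ z, H.Adj (x n) z ∧ z ≠ x (n - 1)) →
      H.Adj (x n) (x (n + 1)) ∧ x (n + 1) ≠ x (n - 1) := by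
  classical
  let nxt : V × V → V × V := fun p =>
    (p.2, if h : ∃ z, H.Adj p.2 z ∧ z ≠ p.1 then h.choose else p.2)
  let t : ℕ → V × V := fun n => nxt^[n] (w, w)
  have ht : ∀ n, t (n + 1) = nxt (t n) := fun n => Function.iterate_succ_apply' _ _ _
  have hprev : ∀ n, (t n).1 = (t (n - 1)).2 := by
    intro n
    cases n with
    | zero => rfl
    | succ n => rw [ht]; rfl
  refine ⟨fun n => (t n).2, rfl, fun n hn => ?_⟩
  simp only [← hprev] at hn ⊢
  have : (t (n + 1)).2 = hn.choose := by
    rw [ht]; exact dif_pos hn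
  rw [this]
  exact hn.choose_spec

/-- A rooted graph any four edges of which lie on a walk from the root that repeats no vertex
before its last one is a path, a ray, a cycle, or a path ending on a cycle. -/
theorem FourEdgeRho.classify (hR : FourEdgeRho H w) : ∃ x : ℕ → V, x 0 = w ∧
    (IsRaySeq H x ∨ (∃ N, IsPathSeq H x N) ∨ ∃ m N, IsLassoSeq H x m N) := by
  obtain ⟨x, hx0, hx⟩ := exists_greedy_seq H w
  have hpred : ∀ i, H.Adj (x i) (x (i - 1)) → 0 < i := fun i h => by
    rcases Nat.eq_zero_or_pos i with rfl | h0
    · exact absurd rfl h.ne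
    · exact h0
  by_cases hall : ∀ n, IsForced H x n
  · refine ⟨x, hx0, Or.inl ⟨fun i => (hall (i + 1)).adj i (by omega), fun i j hij =>
      (hall (i + j)).inj (by omega) (by omega) hij, ?_⟩⟩
    refine hR.edgeSet_subset (S := range x) (E := {e | ∃ i, e = s(x i, x (i + 1))})
      ⟨0, hx0⟩ ?_
    rintro _ ⟨i, rfl⟩ b hb
    rcases (hall (i + 1)).only i (by omega) b hb with rfl | rfl
    · exact ⟨⟨_, rfl⟩, i, rfl⟩
    · exact ⟨⟨_, rfl⟩, i - 1, by rw [Sym2.eq_swap, Nat.sub_add_cancel (hpred i hb)]⟩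
  · push Not at hall
    classical
    have hfind := Nat.find_spec hall
    have hmin := fun k => Nat.find_min hall (m := k)
    generalize Nat.find hall = n at hfind hmin
    rcases Nat.eq_zero_or_pos n with rfl | hn
    · exact absurd ⟨by omega, by omega, by omega⟩ hfind
    -- The sequence is forced up to `k` but not through `k`: either `x k` is a dead end, and `H` is
    -- a path, or `x k` branches, and `H` is a lasso.
    obtain ⟨k, rfl⟩ : ∃ k, n = k + 1 := ⟨n - 1, by omega⟩
    have hk : IsForced H x k := not_not.1 (hmin k (by omega))
    by_cases hfwd : ∃ z, H.Adj (x k) z ∧ z ≠ x (k - 1)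
    · obtain ⟨hadj, hne⟩ := hx k hfwd
      have hq : ∃ q, H.Adj (x k) q ∧ q ≠ x (k + 1) ∧ q ≠ x (k - 1) := by
        by_contra! hc
        refine hfind ⟨fun i hi => ?_, fun i hi => ?_, fun i hi z hz => ?_⟩
        all_goals rcases (by omega : i < k ∨ i = k) with h1 | rfl
        · exact hk.adj i h1
        · exact hadj
        · exact hk.ne i h1
        · exact hne
        · exact hk.only i h1 z hz
        · by_cases h2 : z = x (i + 1)
          · exact Or.inl h2
          · exact Or.inr (hc z hz h2)
      obtain ⟨q, hq, hqne, hqn⟩ := hq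
      obtain ⟨y, M, hy, h1, h2, -⟩ := hR s(x k, x (k + 1)) hadj s(x k, q) hq
        s(x k, q) hq s(x k, q) hq
      obtain ⟨hkM, hyM, hyk⟩ := hk.closed hx0 hy hqne.symm hadj hne hq hqn h1 h2
      have heq : ∀ j ≤ k, y j = x j := fun j hj => hk.eq_of_isRho hx0 hy hj (by omega)
      -- The lasso is read off from `y`, which agrees with `x` up to `k`; the greedy choices of `x`
      -- after `k` are discarded.
      refine ⟨y, hy.zero, Or.inr (Or.inr ⟨k, M, IsForced.isLassoSeq hR hy ⟨?_, ?_, ?_⟩ hkM hyM⟩)⟩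
      · intro i hi; exact hy.adj i (by omega)
      · intro i hi; rw [heq _ (by omega), heq _ (by omega)]; exact hk.ne i hi
      · intro i hi
        rw [heq _ (by omega), heq _ (by omega), heq _ (by omega)]
        exact hk.only i hi
    · push Not at hfwd
      refine ⟨x, hx0, Or.inr (Or.inl ⟨k, hk.adj, fun i j hi hj hij => hk.inj hi hj hij, ?_⟩)⟩
      refine hR.edgeSet_subset (S := {a | ∃ i ≤ k, a = x i}) ⟨0, by omega, hx0.symm⟩ ?_
      rintro _ ⟨i, hi, rfl⟩ b hb
      have hb' : (b = x (i + 1) ∧ i < k) ∨ b = x (i - 1) := by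
        rcases (by omega : i < k ∨ i = k) with h1 | rfl
        · exact (hk.only i h1 b hb).imp (fun h => ⟨h, h1⟩) id
        · exact Or.inr (hfwd b hb)
      rcases hb' with ⟨rfl, h1⟩ | rfl
      · exact ⟨⟨i + 1, h1, rfl⟩, mem_seqEdges_succ h1⟩
      · exact ⟨⟨i - 1, by omega, rfl⟩, mem_seqEdges_pred (hpred i hb) hi⟩

end Rooted

/-! ### Graphs without cut vertices -/

section Whitney

open SimpleGraph

variable {V : Type*} {G : SimpleGraph V}

/-- The walk is stopped at its first vertex in `S`; shortcutting it to a path adds no vertices. -/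
theorem exists_isPath_first_mem {S : Set V} {v u : V} (p : G.Walk v u) (hu : u ∈ S) :
    ∃ z ∈ S, ∃ r : G.Walk v z, r.IsPath ∧ (∀ y ∈ r.support, y ∈ S → y = z) ∧
      r.support ⊆ p.support := by
  classical
  suffices h : ∃ z ∈ S, ∃ r : G.Walk v z, (∀ y ∈ r.support, y ∈ S → y = z) ∧
      r.support ⊆ p.support by
    obtain ⟨z, hz, r, h1, h2⟩ := h
    exact ⟨z, hz, r.bypass, r.bypass_isPath, fun y hy => h1 y (r.support_bypass_subset_support hy),
      fun y hy => h2 (r.support_bypass_subset_support hy)⟩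
  induction p with
  | nil => exact ⟨_, hu, Walk.nil, by simp, by simp⟩
  | @cons a b c h p ih =>
    by_cases ha : a ∈ S
    · exact ⟨a, ha, Walk.nil, by simp, by simp⟩
    · obtain ⟨z, hz, r, h1, h2⟩ := ih hu
      refine ⟨z, hz, Walk.cons h r, ?_, ?_⟩
      · intro y hy hyS
        rw [Walk.support_cons, List.mem_cons] at hy
        rcases hy with rfl | hy
        · exact absurd hyS ha
        · exact h1 y hy hyS
      · simp only [Walk.support_cons]
        exact List.cons_subset_cons _ h2

/-- Two paths that share only an end, and an edge between their other ends, form a cycle. -/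
theorem isCycle_of_two_paths {v w z : V} (h : G.Adj v w) (P : G.Walk w z) (R : G.Walk v z)
    (hP : P.IsPath) (hR : R.IsPath) (hPR : ∀ y ∈ R.support, y ∈ P.support → y = z)
    (hv : v ∉ P.support) (hw : w ∉ R.support) :
    (Walk.cons h (P.append R.reverse)).IsCycle := by
  rw [Walk.cons_isCycle_iff]
  constructor
  · rw [Walk.isPath_def, Walk.support_append, List.nodup_append']
    have hRn : R.reverse.support.Nodup := hR.reverse.support_nodup
    rw [← Walk.cons_tail_support, List.nodup_cons] at hRn
    refine ⟨hP.support_nodup, hRn.2, fun y hyP hyR => ?_⟩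
    have hyR' : y ∈ R.support := by
      have := List.mem_of_mem_tail hyR
      simpa using this
    rw [hPR y hyR' hyP] at hyR
    exact hRn.1 hyR
  · intro he
    rw [Walk.edges_append, List.mem_append] at he
    rcases he with he | he
    · exact hv (P.fst_mem_support_of_mem_edges he)
    · rw [Walk.edges_reverse, List.mem_reverse] at he
      exact hw (R.snd_mem_support_of_mem_edges he)

/-- Whitney: a graph with at least three vertices and no cut vertex is cyclically connected. -/
theorem cyclicallyConnected_of_no_cut (hG : G.Preconnected)
    (h3 : ∀ u v : V, ∃ z, z ≠ u ∧ z ≠ v)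
    (hcut : ∀ w a b : V, a ≠ w → b ≠ w → ∃ p : G.Walk a b, w ∉ p.support) :
    CyclicallyConnected G := by
  classical
  -- An edge `uv` is not a bridge: going from `u` to a third vertex `z` while avoiding `v`, and on
  -- to `v` while avoiding `u`, never uses it.
  have base : ∀ u v, G.Adj u v →
      ∃ (w : V) (c : G.Walk w w), c.IsCycle ∧ u ∈ c.support ∧ v ∈ c.support := by
    intro u v huv
    obtain ⟨z, hzu, hzv⟩ := h3 u v
    obtain ⟨p, hp⟩ := hcut v u z huv.ne hzv
    obtain ⟨q, hq⟩ := hcut u z v hzu huv.ne'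
    have hr : (G.deleteEdges {s(u, v)}).Reachable u v := by
      rw [reachable_deleteEdges_iff_exists_walk]
      refine ⟨p.append q, fun he => ?_⟩
      rw [Walk.edges_append, List.mem_append] at he
      rcases he with he | he
      · exact hp (p.snd_mem_support_of_mem_edges he)
      · exact hq (q.fst_mem_support_of_mem_edges he)
    obtain ⟨w, c, hc, he⟩ := adj_and_reachable_delete_edges_iff_exists_cycle.1 ⟨huv, hr⟩
    exact ⟨w, c, hc, c.fst_mem_support_of_mem_edges he, c.snd_mem_support_of_mem_edges he⟩
  intro v u hvu
  obtain ⟨p⟩ := hG v u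
  induction p with
  | nil => exact absurd rfl hvu
  | @cons v w u h p ih =>
    rcases eq_or_ne w u with rfl | hwu
    · exact base v w h
    obtain ⟨a, c, hc, hwc, huc⟩ := ih hwu
    by_cases hvc : v ∈ c.support
    · exact ⟨a, c, hc, hvc, huc⟩
    obtain ⟨d, hd, hdw⟩ : ∃ d : G.Walk w w, d.IsCycle ∧ ∀ y, y ∈ d.support ↔ y ∈ c.support :=
      ⟨c.rotate w hwc, hc.rotate hwc, fun y => c.mem_support_rotate_iff w hwc⟩
    rw [← hdw] at hvc huc
    -- The new cycle runs from `v` to `w`, along the part of the old cycle containing `u` to the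
    -- point `z` where a path from `v` avoiding `w` first meets it, and back along that path.
    obtain ⟨Q, hQ⟩ := hcut w v u h.ne hwu.symm
    obtain ⟨z, hz, R, hR, hRS, hRQ⟩ := exists_isPath_first_mem (S := {y | y ∈ d.support}) Q huc
    have hwR : w ∉ R.support := fun h => hQ (hRQ h)
    have hzw : z ≠ w := by
      rintro rfl
      exact hwR R.end_mem_support
    have hz' : z ∈ d.support := hz
    have htd := d.take_spec hz'
    have key : ∃ P : G.Walk w z, P.IsPath ∧ P.support ⊆ d.support ∧ u ∈ P.support := by
      have hu2 := huc
      rw [← htd, Walk.mem_support_append_iff] at hu2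
      rcases hu2 with h1 | h1
      · exact ⟨d.takeUntil z hz', hd.isPath_takeUntil hz', d.support_takeUntil_subset_support hz', h1⟩
      · refine ⟨(d.dropUntil z hz').reverse, ?_, ?_, by simpa using h1⟩
        · rw [Walk.isPath_reverse_iff]
          refine Walk.IsCycle.isPath_of_append_right (p := d.takeUntil z hz')
            (Walk.not_nil_of_ne hzw.symm) (by rw [htd]; exact hd)
        · rw [Walk.support_reverse]
          exact fun y hy => d.support_dropUntil_subset_support hz' (List.mem_reverse.1 hy)
    obtain ⟨P, hP, hPd, huP⟩ := key
    refine ⟨v, _, isCycle_of_two_paths h P R hP hR (fun y hy hyP => hRS y hy (hPd hyP))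
      (fun hv => hvc (hPd hv)) hwR, by simp, ?_⟩
    simp [huP]

end Whitney

/-! ### Splitting at a cut vertex -/

section Split

open SimpleGraph

variable {V : Type*} {G HA HB : SimpleGraph V} {w : V}

/-- `G` is the union of `HA` and `HB`, which share at most the vertex `w`. -/
structure IsSplit (G HA HB : SimpleGraph V) (w : V) : Prop where
  adj : ∀ a b, G.Adj a b ↔ HA.Adj a b ∨ HB.Adj a b
  eq : ∀ v a b, HA.Adj v a → HB.Adj v b → v = w

theorem IsSplit.symm (h : IsSplit G HA HB w) : IsSplit G HB HA w :=
  ⟨fun a b => (h.adj a b).trans or_comm, fun v a b h1 h2 => h.eq v b a h2 h1⟩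

theorem IsSplit.not_both (h : IsSplit G HA HB w) {a b : V} (h1 : HA.Adj a b) (h2 : HB.Adj a b) :
    False :=
  h1.ne ((h.eq a b b h1 h2).trans (h.eq b a a h1.symm h2.symm).symm)

/-- A walk can change sides only at `w`. -/
theorem IsSplit.same_side (h : IsSplit G HA HB w) {x : ℕ → V} {N : ℕ}
    (hx : ∀ i < N, G.Adj (x i) (x (i + 1))) (hne : ∀ i, 0 < i → i < N → x i ≠ w) {i j : ℕ}
    (hi : i < N) (hj : j < N) (hA : HA.Adj (x i) (x (i + 1))) : HA.Adj (x j) (x (j + 1)) := by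
  have key : ∀ k < N, (HA.Adj (x 0) (x 1) ↔ HA.Adj (x k) (x (k + 1))) := by
    intro k
    induction k with
    | zero => simp
    | succ k ih =>
      intro hk
      rw [ih (by omega)]
      have hne' := hne (k + 1) (by omega) hk
      constructor
      · intro h1
        rcases (h.adj _ _).1 (hx (k + 1) hk) with h2 | h2
        · exact h2
        · exact absurd (h.eq _ _ _ h1.symm h2) hne'
      · intro h1
        rcases (h.adj _ _).1 (hx k (by omega)) with h2 | h2
        · exact h2
        · exact absurd (h.eq _ _ _ h1 h2.symm) hne'
  exact (key j hj).1 ((key i hi).2 hA)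

theorem IsSplit.isRho (h : IsSplit G HA HB w) {y : ℕ → V} {M : ℕ} (hy : IsRho G w y M)
    {e : Sym2 V} (he : e ∈ HA.edgeSet) (hey : e ∈ seqEdges y M) : IsRho HA w y M := by
  obtain ⟨i, hi, rfl⟩ := hey
  refine ⟨hy.zero, fun j hj => h.same_side hy.adj (fun k hk hkM hkw => ?_) hi hj he, hy.inj⟩
  have := hy.inj _ _ hkM (by omega) (hkw.trans hy.zero.symm)
  omega

/-- The fifth edge `f`, on the other side, forces the walk through `w` at an inner position `k`.
Both halves, read away from `w`, repeat no vertex before their last, so each stays on one side. -/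
theorem IsSplit.fourEdgeRho (h : IsSplit G HA HB w)
    (h5 : ∀ F : Finset (Sym2 V), (∀ e ∈ F, e ∈ G.edgeSet) → F.card ≤ 5 →
      ∃ (x : ℕ → V) (N : ℕ), IsInnerPath G x N ∧ ∀ e ∈ F, e ∈ seqEdges x N)
    {f : Sym2 V} (hf : f ∈ HB.edgeSet) : FourEdgeRho HA w := by
  classical
  have hAG : ∀ e ∈ HA.edgeSet, e ∈ G.edgeSet := by
    intro e
    induction e with | _ a b => exact fun h' => (h.adj a b).2 (Or.inl h')
  have hBG : ∀ e ∈ HB.edgeSet, e ∈ G.edgeSet := by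
    intro e
    induction e with | _ a b => exact fun h' => (h.adj a b).2 (Or.inr h')
  have hdisj : ∀ e ∈ HA.edgeSet, e ∉ HB.edgeSet := by
    intro e
    induction e with | _ a b => exact fun h1 h2 => h.not_both h1 h2
  intro e₁ h₁ e₂ h₂ e₃ h₃ e₄ h₄
  obtain ⟨x, N, hx, hF⟩ := h5 {e₁, e₂, e₃, e₄, f} (by
    simp only [Finset.mem_insert, Finset.mem_singleton]
    rintro e (rfl | rfl | rfl | rfl | rfl)
    exacts [hAG _ h₁, hAG _ h₂, hAG _ h₃, hAG _ h₄, hBG _ hf]) Finset.card_le_five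
  obtain ⟨k, hk0, hkN, hkw⟩ : ∃ k, 0 < k ∧ k < N ∧ x k = w := by
    by_contra! hc
    obtain ⟨i, hi, hei⟩ := hF e₁ (by simp)
    obtain ⟨j, hj, hej⟩ := hF f (by simp)
    refine hdisj f ?_ hf
    rw [hej]
    rw [hei] at h₁
    exact h.same_side hx.adj hc hi hj h₁
  have hy : IsRho G w (fun i => x (k + i)) (N - k) := by
    refine ⟨hkw, fun i hi => hx.adj _ (by omega), fun i j hi hj hij => ?_⟩
    have := hx.inj _ _ (by omega) (by omega) (by omega) (by omega) hij
    omega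
  have hy' : IsRho G w (fun i => x (k - i)) k := by
    refine ⟨hkw, fun i hi => ?_, fun i j hi hj hij => ?_⟩
    · have := hx.adj (k - (i + 1)) (by omega)
      rw [show k - (i + 1) + 1 = k - i by omega] at this
      exact this.symm
    · have := hx.inj _ _ (by omega) (by omega) (by omega) (by omega) hij
      omega
  have hcov : ∀ e ∈ seqEdges x N, e ∈ seqEdges (fun i => x (k + i)) (N - k) ∨
      e ∈ seqEdges (fun i => x (k - i)) k := by
    rintro e ⟨i, hi, rfl⟩
    rcases le_or_gt k i with h1 | h1
    · refine Or.inl ⟨i - k, by omega, ?_⟩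
      dsimp only
      rw [show k + (i - k) = i by omega, show k + (i - k + 1) = i + 1 by omega]
    · refine Or.inr ⟨k - (i + 1), by omega, ?_⟩
      dsimp only
      rw [show k - (k - (i + 1)) = i + 1 by omega, show k - (k - (i + 1) + 1) = i by omega,
        Sym2.eq_swap]
  -- Stated for both halves at once, as either may be the one containing `e₁`. That half lies in
  -- `HA`, so `f` puts the other one in `HB` and all four edges are on the first.
  have main : ∀ (y y' : ℕ → V) (M M' : ℕ), IsRho G w y M → IsRho G w y' M' →
      (∀ e ∈ seqEdges x N, e ∈ seqEdges y M ∨ e ∈ seqEdges y' M') → e₁ ∈ seqEdges y M →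
      ∃ y N, IsRho HA w y N ∧ e₁ ∈ seqEdges y N ∧ e₂ ∈ seqEdges y N ∧
        e₃ ∈ seqEdges y N ∧ e₄ ∈ seqEdges y N := by
    intro y y' M M' hy hy' hcov he
    have hyA := h.isRho hy h₁ he
    have hsub : ∀ (H : SimpleGraph V) (y : ℕ → V) (M : ℕ), IsRho H w y M →
        ∀ e ∈ seqEdges y M, e ∈ H.edgeSet := by
      rintro H y M hy e ⟨i, hi, rfl⟩
      exact hy.adj i hi
    have hfy' : f ∈ seqEdges y' M' := by
      rcases hcov f (hF f (by simp)) with h1 | h1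
      · exact absurd hf (hdisj f (hsub _ _ _ hyA f h1))
      · exact h1
    have hyB := h.symm.isRho hy' hf hfy'
    have hin : ∀ e ∈ HA.edgeSet, e ∈ seqEdges x N → e ∈ seqEdges y M := by
      intro e heA hex
      rcases hcov e hex with h1 | h1
      · exact h1
      · exact absurd (hsub _ _ _ hyB e h1) (hdisj e heA)
    exact ⟨y, M, hyA, he, hin _ h₂ (hF _ (by simp)), hin _ h₃ (hF _ (by simp)),
      hin _ h₄ (hF _ (by simp))⟩
  rcases hcov e₁ (hF e₁ (by simp)) with h1 | h1
  · exact main _ _ _ _ hy hy' hcov h1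
  · exact main _ _ _ _ hy' hy (fun e he => (hcov e he).symm) h1

/-- The edges of `G` with an end in `A`. -/
def edgesAt (G : SimpleGraph V) (A : Set V) : SimpleGraph V where
  Adj a b := G.Adj a b ∧ (a ∈ A ∨ b ∈ A)
  symm := ⟨fun _ _ h => ⟨h.1.symm, h.2.symm⟩⟩
  loopless := ⟨fun _ h => h.1.ne rfl⟩

theorem exists_split (hG : G.Preconnected) {a b : V} (ha : a ≠ w) (hb : b ≠ w)
    (hab : ∀ p : G.Walk a b, w ∈ p.support) :
    ∃ HA HB : SimpleGraph V, IsSplit G HA HB w ∧ HA.edgeSet.Nonempty ∧ HB.edgeSet.Nonempty := by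
  have hadj : ∀ v, v ≠ w → ∃ u, G.Adj v u := by
    intro v hv
    have : Nontrivial V := ⟨v, w, hv⟩
    exact hG.exists_adj_of_nontrivial v
  -- The component of `a` in `G - w`. Every edge has an end other than `w`, which decides its side.
  set A : Set V := {x | ∃ p : G.Walk a x, w ∉ p.support} with hA
  have hAw : w ∉ A := fun ⟨p, hp⟩ => hp p.end_mem_support
  have hstep : ∀ x y, x ∈ A → G.Adj x y → y = w ∨ y ∈ A := by
    rintro x y ⟨p, hp⟩ hxy
    by_cases hy : y = w
    · exact Or.inl hy
    · refine Or.inr ⟨p.concat hxy, ?_⟩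
      rw [Walk.support_concat]
      simp [hp, Ne.symm hy]
  have haA : a ∈ A := ⟨Walk.nil, by simpa using ha.symm⟩
  have hbA : b ∉ A := fun ⟨p, hp⟩ => hp (hab p)
  refine ⟨edgesAt G A, edgesAt G {x | x ≠ w ∧ x ∉ A}, ⟨fun x y => ?_, fun v x y h1 h2 => ?_⟩, ?_, ?_⟩
  · simp only [edgesAt, ← and_or_left]
    refine (and_iff_left_of_imp fun hxy => ?_).symm
    by_contra! hc
    obtain ⟨⟨h1, h2⟩, h3, h4⟩ := hc
    have hx : x = w := by
      by_contra hx; exact h3 ⟨hx, h1⟩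
    have hy : y = w := by
      by_contra hy; exact h4 ⟨hy, h2⟩
    exact hxy.ne (hx.trans hy.symm)
  · by_contra hv
    obtain ⟨h1, h1'⟩ := h1
    obtain ⟨h2, h2'⟩ := h2
    have hvA : v ∈ A := by
      rcases h1' with h | h
      · exact h
      · exact (hstep _ _ h h1.symm).resolve_left hv
    rcases h2' with h | h
    · exact h.2 hvA
    · rcases hstep _ _ hvA h2 with h3 | h3
      · exact h.1 h3
      · exact h.2 h3
  · obtain ⟨u, hu⟩ := hadj a ha
    exact ⟨s(a, u), hu, Or.inl haA⟩
  · obtain ⟨u, hu⟩ := hadj b hb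
    exact ⟨s(b, u), hu, Or.inl ⟨hb, hbA⟩⟩

end Split

/-! ### The one-complex as a quotient of a real interval -/

section Param

variable {V : Type*} {G : SimpleGraph V}

/-- `G` is traversed by the vertices `z k`, for the integers `k` in `K`, each edge exactly once. -/
structure IsTraversal (G : SimpleGraph V) (z : ℤ → V) (K : Set ℝ) : Prop where
  closed : IsClosed K
  floor : ∀ t ∈ K, ((⌊t⌋ : ℤ) : ℝ) ∈ K
  ceil : ∀ t ∈ K, ((⌈t⌉ : ℤ) : ℝ) ∈ K
  ord : OrdConnected K
  adj : ∀ k : ℤ, (k : ℝ) ∈ K → ((k + 1 : ℤ) : ℝ) ∈ K → G.Adj (z k) (z (k + 1))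
  edge : ∀ e ∈ G.edgeSet, ∃ k : ℤ, (k : ℝ) ∈ K ∧ ((k + 1 : ℤ) : ℝ) ∈ K ∧ e = s(z k, z (k + 1))
  inj : ∀ k l : ℤ, (k : ℝ) ∈ K → ((k + 1 : ℤ) : ℝ) ∈ K → (l : ℝ) ∈ K → ((l + 1 : ℤ) : ℝ) ∈ K →
    s(z k, z (k + 1)) = s(z l, z (l + 1)) → k = l
  vert : ∀ v, ∃ k : ℤ, (k : ℝ) ∈ K ∧ v = z k

theorem locallyFinite_Icc_int : LocallyFinite fun k : ℤ => Icc (k : ℝ) (k + 1) :=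
  locallyFinite_Icc_of_tendsto (tendsto_intCast_atTop_atTop)
    (Filter.tendsto_atBot_add_const_right _ _ (tendsto_intCast_atBot_iff.2 Filter.tendsto_id))

/-- `φ` runs along the edge from `z k` to `z (k + 1)` on `[k, k + 1]`; the floor and ceiling
conditions make `K` consist of whole such intervals or isolated integers. It is a quotient map
because openness in `|G|` is tested on edges and each `edgeMap` factors continuously through `φ`. -/
theorem IsTraversal.exists_isQuotientMap {z : ℤ → V} {K : Set ℝ} (h : IsTraversal G z K) :
    ∃ φ : K → Complex G, IsQuotientMap φ ∧ ∀ s t : K, φ s = φ t ↔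
      s = t ∨ ∃ k l : ℤ, (s : ℝ) = k ∧ (t : ℝ) = l ∧ z k = z l := by
  have hf : ∀ k : ℤ, ∃ f : ℝ → Complex G, f 0 = vtx G (z k) ∧
      ((k : ℝ) ∈ K → ((k + 1 : ℤ) : ℝ) ∈ K → Continuous f ∧ f 1 = vtx G (z (k + 1)) ∧
        InjOn f (Icc 0 1) ∧
        (∀ t ∈ Ioo (0 : ℝ) 1, ∃ e : G.edgeSet, e.1 = s(z k, z (k + 1)) ∧ f t ∈ openEdge e) ∧
        ∃ r : unitInterval → unitInterval, Continuous r ∧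
          ∀ e : G.edgeSet, e.1 = s(z k, z (k + 1)) → ∀ s, edgeMap e s = f (r s)) := by
    intro k
    by_cases hk : (k : ℝ) ∈ K ∧ ((k + 1 : ℤ) : ℝ) ∈ K
    · obtain ⟨f, h1, h2, h3, h4, h5, r, hr, h6⟩ := exists_edge_param (h.adj k hk.1 hk.2)
      refine ⟨f, h2, fun _ _ => ⟨h1, h3, h4, fun t ht => ⟨_, rfl, h5 t ht⟩, r, hr, ?_⟩⟩
      rintro ⟨e, he⟩ hek s
      obtain rfl : e = s(z k, z (k + 1)) := hek
      exact h6 s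
    · exact ⟨fun _ => vtx G (z k), rfl, fun h1 h2 => absurd ⟨h1, h2⟩ hk⟩
  choose f hf0 hf using hf
  set φ : ℝ → Complex G := fun t => f ⌊t⌋ (t - ⌊t⌋) with hφ
  have hint : ∀ k : ℤ, φ k = vtx G (z k) := fun k => by simp [hφ, hf0]
  have hIcc : ∀ k : ℤ, (k : ℝ) ∈ K → ((k + 1 : ℤ) : ℝ) ∈ K → ∀ t ∈ Icc (k : ℝ) (k + 1),
      φ t = f k (t - k) := by
    intro k h1 h2 t ht
    rcases eq_or_lt_of_le ht.2 with h3 | h3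
    · have : φ ((k + 1 : ℤ) : ℝ) = f k 1 := by rw [hint, (hf k h1 h2).2.1]
      rw [h3]
      push_cast at this
      rw [this]
      congr 1
      ring
    · have : ⌊t⌋ = k := Int.floor_eq_iff.2 ⟨ht.1, h3⟩
      simp only [hφ, this]
  have hnonint : ∀ t ∈ K, (∃ k : ℤ, t = k) ∨ ∃ k : ℤ, (k : ℝ) ∈ K ∧ ((k + 1 : ℤ) : ℝ) ∈ K ∧
      t - k ∈ Ioo (0 : ℝ) 1 := by
    intro t ht
    by_cases hk : ∃ k : ℤ, t = k
    · exact Or.inl hk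
    · push Not at hk
      have h1 : (⌊t⌋ : ℝ) < t := lt_of_le_of_ne (Int.floor_le t) (hk _).symm
      have h2 := Int.lt_floor_add_one t
      have h3 : ⌈t⌉ = ⌊t⌋ + 1 := by
        rw [Int.ceil_eq_iff]
        push_cast
        exact ⟨by linarith, h2.le⟩
      exact Or.inr ⟨⌊t⌋, h.floor t ht, h3 ▸ h.ceil t ht, by linarith, by linarith⟩
  have hcont : ContinuousOn φ K := by
    have hK : K = ⋃ k : ℤ, Icc (k : ℝ) (k + 1) ∩ K := by
      rw [← iUnion_inter, eq_comm, inter_eq_right]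
      intro t _
      exact mem_iUnion.2 ⟨⌊t⌋, Int.floor_le t, (Int.lt_floor_add_one t).le⟩
    rw [hK]
    refine LocallyFinite.continuousOn_iUnion
      (locallyFinite_Icc_int.subset fun _ => inter_subset_left)
      (fun k => isClosed_Icc.inter h.closed) fun k => ?_
    by_cases hk : (k : ℝ) ∈ K ∧ ((k + 1 : ℤ) : ℝ) ∈ K
    · refine ContinuousOn.congr (f := fun t => f k (t - k)) ?_
        fun t ht => hIcc k hk.1 hk.2 t ht.1
      exact ((hf k hk.1 hk.2).1.comp (by fun_prop)).continuousOn
    -- If `[k, k + 1]` is not contained in `K`, it meets `K` in at most one of its ends.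
    · refine Set.Subsingleton.continuousOn ?_ _
      have key : ∀ t ∈ Icc (k : ℝ) (k + 1) ∩ K, (t = k ∧ (k : ℝ) ∈ K) ∨
          (t = (k + 1 : ℤ) ∧ ((k + 1 : ℤ) : ℝ) ∈ K) := by
        rintro t ⟨⟨h1, h2⟩, htK⟩
        rcases eq_or_lt_of_le h1 with h3 | h3
        · exact Or.inl ⟨h3.symm, h3 ▸ htK⟩
        rcases eq_or_lt_of_le h2 with h4 | h4
        · refine Or.inr ⟨by push_cast; exact h4, ?_⟩
          push_cast
          exact h4 ▸ htK
        · refine absurd ⟨?_, ?_⟩ hk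
          · rw [← Int.floor_eq_iff.2 ⟨h1, h4⟩]
            exact h.floor t htK
          · have : ⌈t⌉ = k + 1 := by
              rw [Int.ceil_eq_iff]
              push_cast
              exact ⟨by linarith, h2⟩
            rw [← this]
            exact h.ceil t htK
      intro s hs t ht
      rcases key s hs with ⟨h1, h1'⟩ | ⟨h1, h1'⟩ <;> rcases key t ht with ⟨h2, h2'⟩ | ⟨h2, h2'⟩
      · rw [h1, h2]
      · exact absurd ⟨h1', h2'⟩ hk
      · exact absurd ⟨h2', h1'⟩ hk
      · rw [h1, h2]
  have hedge : ∀ e : G.edgeSet, ∃ ρ : unitInterval → K, Continuous ρ ∧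
      ∀ s, edgeMap e s = φ (ρ s) := by
    intro e
    obtain ⟨k, h1, h2, hek⟩ := h.edge e.1 e.2
    obtain ⟨r, hr, hrf⟩ := (hf k h1 h2).2.2.2.2
    have hmem : ∀ s : unitInterval, (k : ℝ) + r s ∈ Icc (k : ℝ) (k + 1) := fun s =>
      ⟨by linarith [(r s).2.1], by linarith [(r s).2.2]⟩
    refine ⟨fun s => ⟨k + r s, h.ord.out h1 h2 ?_⟩, ?_, fun s => ?_⟩
    · have := hmem s
      push_cast
      exact this
    · refine Continuous.subtype_mk ?_ _
      fun_prop
    · rw [hrf e hek s, hIcc k h1 h2 _ (hmem s)]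
      simp
  refine ⟨fun t => φ t, ⟨isCoinducing_iff.2 fun U => ⟨fun hU => ?_, fun hU => ?_⟩, ?_⟩, ?_⟩
  · refine isOpen_complex_iff.2 fun e => ?_
    obtain ⟨ρ, hρc, hρ⟩ := hedge e
    have : edgeMap e ⁻¹' U = ρ ⁻¹' ((fun t : K => φ t) ⁻¹' U) := by
      ext s
      simp [hρ]
    rw [this]
    exact hU.preimage hρc
  · exact hU.preimage (continuousOn_iff_continuous_domRestrict.1 hcont)
  · intro p
    rcases exists_vtx_or_edgeMap p with ⟨v, rfl⟩ | ⟨e, s, -, -, rfl⟩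
    · obtain ⟨k, hk, rfl⟩ := h.vert v
      exact ⟨⟨k, hk⟩, hint k⟩
    · obtain ⟨ρ, -, hρ⟩ := hedge e
      exact ⟨ρ s, (hρ s).symm⟩
  · rintro ⟨s, hs⟩ ⟨t, ht⟩
    simp only [Subtype.mk.injEq]
    constructor
    · intro hst
      rcases hnonint s hs with ⟨k, rfl⟩ | ⟨k, h1, h2, hk⟩ <;>
        rcases hnonint t ht with ⟨l, rfl⟩ | ⟨l, h3, h4, hl⟩
      · rw [hint, hint] at hst
        exact Or.inr ⟨k, l, rfl, rfl, vtx_injective hst⟩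
      · obtain ⟨e, -, he⟩ := (hf l h3 h4).2.2.2.1 _ hl
        rw [hint, hIcc l h3 h4 t ⟨by linarith [hl.1], by linarith [hl.2]⟩] at hst
        exact absurd (hst ▸ he) (vtx_notMem_openEdge _ _)
      · obtain ⟨e, -, he⟩ := (hf k h1 h2).2.2.2.1 _ hk
        rw [hint, hIcc k h1 h2 s ⟨by linarith [hk.1], by linarith [hk.2]⟩] at hst
        exact absurd (hst ▸ he) (vtx_notMem_openEdge _ _)
      · obtain ⟨e, he', he⟩ := (hf k h1 h2).2.2.2.1 _ hk
        obtain ⟨e', hee', hl'⟩ := (hf l h3 h4).2.2.2.1 _ hl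
        rw [hIcc k h1 h2 s ⟨by linarith [hk.1], by linarith [hk.2]⟩,
          hIcc l h3 h4 t ⟨by linarith [hl.1], by linarith [hl.2]⟩] at hst
        rw [← hst] at hl'
        obtain rfl := openEdge_eq_of_mem he hl'
        obtain rfl := h.inj k l h1 h2 h3 h4 (he'.symm.trans hee')
        have := (hf k h1 h2).2.2.1 (Ioo_subset_Icc_self hk) (Ioo_subset_Icc_self hl) hst
        exact Or.inl (by linarith)
    · rintro (rfl | ⟨k, l, rfl, rfl, hkl⟩)
      · rfl
      · rw [hint, hint, hkl]

/-- Two quotients of one space with the same fibres; every comparison of `|G|` with a model goes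
through this. -/
theorem nonempty_homeomorph_of_isQuotientMap {K X Y : Type*} [TopologicalSpace K]
    [TopologicalSpace X] [TopologicalSpace Y] {φ : K → X} {g : K → Y} (hφ : IsQuotientMap φ)
    (hg : IsQuotientMap g) (h : ∀ s t, φ s = φ t ↔ g s = g t) : Nonempty (X ≃ₜ Y) := by
  have h1 : Function.FactorsThrough g φ := fun s t hst => (h s t).1 hst
  have h2 : Function.FactorsThrough φ g := fun s t hst => (h s t).2 hst
  let F : C(X, Y) := IsQuotientMap.lift (f := ⟨φ, hφ.continuous⟩) hφ ⟨g, hg.continuous⟩ h1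
  let F' : C(Y, X) := IsQuotientMap.lift (f := ⟨g, hg.continuous⟩) hg ⟨φ, hφ.continuous⟩ h2
  have hF : ∀ s, F (φ s) = g s := fun s => DFunLike.congr_fun
    (IsQuotientMap.lift_comp (f := ⟨φ, hφ.continuous⟩) hφ ⟨g, hg.continuous⟩ h1) s
  have hF' : ∀ s, F' (g s) = φ s := fun s => DFunLike.congr_fun
    (IsQuotientMap.lift_comp (f := ⟨g, hg.continuous⟩) hg ⟨φ, hφ.continuous⟩ h2) s
  refine ⟨⟨⟨F, F', fun x => ?_, fun y => ?_⟩, F.continuous, F'.continuous⟩⟩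
  · obtain ⟨s, rfl⟩ := hφ.surjective x
    rw [hF, hF']
  · obtain ⟨s, rfl⟩ := hg.surjective y
    rw [hF', hF]

end Param

/-! ### Parametrizations of the planar models -/

section Shapes

/-- `g` maps `K` continuously onto `S`, identifying points exactly as the relation `r` does. -/
structure IsGluing (g : ℝ → ℂ) (K : Set ℝ) (S : Set ℂ) (r : ℝ → ℝ → Prop) : Prop where
  cont : ContinuousOn g K
  image : g '' K = S
  ker : ∀ s ∈ K, ∀ t ∈ K, g s = g t ↔ r s t

theorem IsGluing.congr {g : ℝ → ℂ} {K : Set ℝ} {S : Set ℂ} {r r' : ℝ → ℝ → Prop}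
    (h : IsGluing g K S r) (hr : ∀ s ∈ K, ∀ t ∈ K, r s t ↔ r' s t) : IsGluing g K S r' :=
  ⟨h.cont, h.image, fun s hs t ht => (h.ker s hs t ht).trans (hr s hs t ht)⟩

/-- The identifications of a concatenation at `b` of two maps with identifications `r₁`, `r₂`. -/
def glueRel (b : ℝ) (r₁ r₂ : ℝ → ℝ → Prop) (s t : ℝ) : Prop :=
  (s ≤ b ∧ t ≤ b ∧ r₁ s t) ∨ (b ≤ s ∧ b ≤ t ∧ r₂ s t) ∨ (s ≤ b ∧ b ≤ t ∧ r₁ s b ∧ r₂ b t) ∨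
    (b ≤ s ∧ t ≤ b ∧ r₂ s b ∧ r₁ b t)

theorem IsGluing.glue {g₁ g₂ : ℝ → ℂ} {K₁ K₂ : Set ℝ} {S₁ S₂ : Set ℂ} {r₁ r₂ : ℝ → ℝ → Prop}
    (h₁ : IsGluing g₁ K₁ S₁ r₁) (h₂ : IsGluing g₂ K₂ S₂ r₂) {b : ℝ} (hc₁ : IsClosed K₁)
    (hc₂ : IsClosed K₂) (hK₁ : K₁ ⊆ Iic b) (hK₂ : K₂ ⊆ Ici b) (hb₁ : b ∈ K₁) (hb₂ : b ∈ K₂)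
    (hb : g₁ b = g₂ b) (hS : S₁ ∩ S₂ ⊆ {g₁ b}) :
    IsGluing (fun t => if t ≤ b then g₁ t else g₂ t) (K₁ ∪ K₂) (S₁ ∪ S₂) (glueRel b r₁ r₂) := by
  set g : ℝ → ℂ := fun t => if t ≤ b then g₁ t else g₂ t with hg
  have e₁ : EqOn g g₁ K₁ := fun t ht => if_pos (hK₁ ht)
  have e₂ : EqOn g g₂ K₂ := fun t ht => by
    have hbt : b ≤ t := hK₂ ht
    rcases eq_or_lt_of_le hbt with rfl | h
    · rw [hg]; simp only [le_refl, if_true]; exact hb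
    · exact if_neg (not_le.2 h)
  have cross : ∀ s ∈ K₁, ∀ t ∈ K₂, g s = g t ↔ r₁ s b ∧ r₂ b t := by
    intro s hs t ht
    rw [e₁ hs, e₂ ht, ← h₁.ker s hs b hb₁, ← h₂.ker b hb₂ t ht]
    constructor
    · intro h
      have hm : g₁ s ∈ S₁ ∩ S₂ := ⟨h₁.image ▸ mem_image_of_mem _ hs,
        h ▸ h₂.image ▸ mem_image_of_mem _ ht⟩
      have := hS hm
      rw [mem_singleton_iff] at this
      exact ⟨this, by rw [← hb, ← this, h]⟩
    · rintro ⟨h1, h2⟩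
      rw [h1, hb, h2]
  refine ⟨?_, ?_, ?_⟩
  · exact ContinuousOn.union_of_isClosed (h₁.cont.congr e₁) (h₂.cont.congr e₂) hc₁ hc₂
  · rw [image_union, e₁.image_eq, e₂.image_eq, h₁.image, h₂.image]
  · have hsymm₁ : ∀ s ∈ K₁, ∀ t ∈ K₁, r₁ s t ↔ r₁ t s := fun s hs t ht => by
      rw [← h₁.ker s hs t ht, ← h₁.ker t ht s hs, eq_comm]
    have hsymm₂ : ∀ s ∈ K₂, ∀ t ∈ K₂, r₂ s t ↔ r₂ t s := fun s hs t ht => by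
      rw [← h₂.ker s hs t ht, ← h₂.ker t ht s hs, eq_comm]
    have hr₁ : r₁ b b := (h₁.ker b hb₁ b hb₁).1 rfl
    have hr₂ : r₂ b b := (h₂.ker b hb₂ b hb₂).1 rfl
    intro s hs t ht
    have hs₁ : s ∈ K₁ ↔ s ≤ b := ⟨fun h => hK₁ h, fun h => hs.elim id fun h' => by
      rwa [le_antisymm h (hK₂ h')]⟩
    have hs₂ : s ∈ K₂ ↔ b ≤ s := ⟨fun h => hK₂ h, fun h => hs.elim (fun h' => by
      rwa [le_antisymm (hK₁ h') h]) id⟩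
    have ht₁ : t ∈ K₁ ↔ t ≤ b := ⟨fun h => hK₁ h, fun h => ht.elim id fun h' => by
      rwa [le_antisymm h (hK₂ h')]⟩
    have ht₂ : t ∈ K₂ ↔ b ≤ t := ⟨fun h => hK₂ h, fun h => ht.elim (fun h' => by
      rwa [le_antisymm (hK₁ h') h]) id⟩
    constructor
    · intro h
      rcases hs with hs' | hs' <;> rcases ht with ht' | ht'
      · rw [e₁ hs', e₁ ht', h₁.ker s hs' t ht'] at h
        exact Or.inl ⟨hK₁ hs', hK₁ ht', h⟩
      · exact Or.inr (Or.inr (Or.inl ⟨hK₁ hs', hK₂ ht', (cross s hs' t ht').1 h⟩))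
      · obtain ⟨h1, h2⟩ := (cross t ht' s hs').1 h.symm
        exact Or.inr (Or.inr (Or.inr ⟨hK₂ hs', hK₁ ht', (hsymm₂ _ hb₂ _ hs').1 h2,
          (hsymm₁ _ ht' _ hb₁).1 h1⟩))
      · rw [e₂ hs', e₂ ht', h₂.ker s hs' t ht'] at h
        exact Or.inr (Or.inl ⟨hK₂ hs', hK₂ ht', h⟩)
    · rintro (⟨h1, h2, h3⟩ | ⟨h1, h2, h3⟩ | ⟨h1, h2, h3⟩ | ⟨h1, h2, h3, h4⟩)
      · rw [e₁ (hs₁.2 h1), e₁ (ht₁.2 h2)]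
        exact (h₁.ker _ (hs₁.2 h1) _ (ht₁.2 h2)).2 h3
      · rw [e₂ (hs₂.2 h1), e₂ (ht₂.2 h2)]
        exact (h₂.ker _ (hs₂.2 h1) _ (ht₂.2 h2)).2 h3
      · exact (cross s (hs₁.2 h1) t (ht₂.2 h2)).2 h3
      · exact ((cross t (ht₁.2 h2) s (hs₂.2 h1)).2 ⟨(hsymm₁ _ hb₁ _ (ht₁.2 h2)).1 h4,
          (hsymm₂ _ (hs₂.2 h1) _ hb₂).1 h3⟩).symm

theorem exp_two_pi_eq_iff {u v : ℝ} (hu : u ∈ Icc (0 : ℝ) 1) (hv : v ∈ Icc (0 : ℝ) 1) :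
    Complex.exp (2 * Real.pi * Complex.I * u) = Complex.exp (2 * Real.pi * Complex.I * v) ↔
      u = v ∨ (u = 0 ∧ v = 1) ∨ (u = 1 ∧ v = 0) := by
  constructor
  · intro h
    obtain ⟨n, hn⟩ := Complex.exp_eq_exp_iff_exists_int.1 h
    have h2 : (u : ℂ) = v + n := by
      have h0 : (2 * Real.pi * Complex.I : ℂ) ≠ 0 := Complex.two_pi_I_ne_zero
      have : (2 * Real.pi * Complex.I : ℂ) * (u - (v + n)) = 0 := by linear_combination hn
      rcases mul_eq_zero.1 this with h | h
      · exact absurd h h0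
      · exact sub_eq_zero.1 h
    have h3 : u = v + n := by exact_mod_cast h2
    have h4 : (n : ℝ) ≤ 1 := by linarith [hu.2, hv.1]
    have h5 : (-1 : ℝ) ≤ n := by linarith [hu.1, hv.2]
    have h4' : n ≤ 1 := by exact_mod_cast h4
    have h5' : -1 ≤ n := by exact_mod_cast h5
    obtain rfl | rfl | rfl : n = -1 ∨ n = 0 ∨ n = 1 := by omega
    · push_cast at h3
      exact Or.inr (Or.inl ⟨by linarith [hu.1, hv.2], by linarith [hu.1, hv.2]⟩)
    · left; simpa using h3
    · push_cast at h3
      exact Or.inr (Or.inr ⟨by linarith [hu.2, hv.1], by linarith [hu.2, hv.1]⟩)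
  · rintro (rfl | ⟨rfl, rfl⟩ | ⟨rfl, rfl⟩)
    · rfl
    · simp [Complex.exp_two_pi_mul_I]
    · simp [Complex.exp_two_pi_mul_I]

theorem exists_exp_two_pi_eq {z : ℂ} (hz : ‖z‖ = 1) :
    ∃ u ∈ Icc (0 : ℝ) 1, Complex.exp (2 * Real.pi * Complex.I * u) = z := by
  have hpi := Real.pi_pos
  have h1 := Complex.norm_mul_exp_arg_mul_I z
  rw [hz, Complex.ofReal_one, one_mul] at h1
  have hpi' : (Real.pi : ℂ) ≠ 0 := by exact_mod_cast hpi.ne'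
  rcases le_or_gt 0 z.arg with h | h
  · refine ⟨z.arg / (2 * Real.pi), ⟨by positivity, ?_⟩, ?_⟩
    · rw [div_le_one (by positivity)]
      linarith [Complex.arg_le_pi z]
    · rw [← h1]
      congr 1
      rw [h1]
      push_cast
      field_simp
  -- The argument lies in `(-π, π]`; negative values are shifted by one turn.
  · refine ⟨z.arg / (2 * Real.pi) + 1, ⟨?_, ?_⟩, ?_⟩
    · have : -1 ≤ z.arg / (2 * Real.pi) := by
        rw [le_div_iff₀ (by positivity)]
        linarith [Complex.neg_pi_lt_arg z]
      linarith
    · have : z.arg / (2 * Real.pi) ≤ 0 := div_nonpos_of_nonpos_of_nonneg h.le (by positivity)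
      linarith
    · have : (2 * Real.pi * Complex.I * ((z.arg / (2 * Real.pi) + 1 : ℝ) : ℂ)) =
          z.arg * Complex.I + 2 * Real.pi * Complex.I := by
        push_cast
        field_simp
      rw [this, Complex.exp_add, Complex.exp_two_pi_mul_I, mul_one, h1]

theorem div_mem_Icc {a b t : ℝ} (hab : a < b) (ht : t ∈ Icc a b) :
    (t - a) / (b - a) ∈ Icc (0 : ℝ) 1 :=
  ⟨div_nonneg (by linarith [ht.1]) (by linarith),
    (div_le_one (by linarith)).2 (by linarith [ht.2])⟩

/-- Parametrization of the unit circle about `p` that starts and ends at `p + ε`. -/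
noncomputable def circleMap' (p ε : ℂ) (a b t : ℝ) : ℂ :=
  p + ε * Complex.exp (2 * Real.pi * Complex.I * ((t - a) / (b - a) : ℝ))

theorem circleMap'_left (p ε : ℂ) (a b : ℝ) : circleMap' p ε a b a = p + ε := by
  simp [circleMap']

theorem circleMap'_right (p ε : ℂ) {a b : ℝ} (hab : a < b) :
    circleMap' p ε a b b = p + ε := by
  rw [circleMap', div_self (by linarith)]
  simp [Complex.exp_two_pi_mul_I]

theorem isGluing_circle (p : ℂ) {ε : ℂ} (hε : ‖ε‖ = 1) {a b : ℝ} (hab : a < b) :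
    IsGluing (circleMap' p ε a b) (Icc a b) (Metric.sphere p 1)
      (fun s t => s = t ∨ (s = a ∧ t = b) ∨ (s = b ∧ t = a)) := by
  have hε0 : ε ≠ 0 := by
    rintro rfl
    simp at hε
  have hba : b - a ≠ 0 := by linarith
  refine ⟨?_, ?_, ?_⟩
  · refine Continuous.continuousOn ?_
    unfold circleMap'
    fun_prop
  · ext z
    rw [mem_sphere_iff_norm]
    constructor
    · rintro ⟨t, ht, rfl⟩
      rw [circleMap', add_sub_cancel_left, norm_mul, hε, one_mul,
        show 2 * Real.pi * Complex.I * (((t - a) / (b - a) : ℝ) : ℂ) =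
          ((2 * Real.pi * ((t - a) / (b - a)) : ℝ) : ℂ) * Complex.I by push_cast; ring,
        Complex.norm_exp_ofReal_mul_I]
    · intro hz
      obtain ⟨u, hu, hue⟩ := exists_exp_two_pi_eq (z := (z - p) / ε) (by rw [norm_div, hz, hε, div_one])
      refine ⟨a + u * (b - a), ⟨by nlinarith [hu.1], by nlinarith [hu.2]⟩, ?_⟩
      rw [circleMap', add_sub_cancel_left, mul_div_assoc, div_self hba, mul_one, hue,
        mul_div_cancel₀ _ hε0]
      ring
  · intro s hs t ht
    rw [circleMap', circleMap', add_right_inj, mul_right_inj' hε0,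
      exp_two_pi_eq_iff (div_mem_Icc hab hs) (div_mem_Icc hab ht), div_left_inj' hba,
      div_eq_zero_iff, div_eq_zero_iff, div_eq_one_iff_eq hba, div_eq_one_iff_eq hba]
    simp only [hba, or_false, sub_left_inj, sub_eq_zero]

theorem mem_segment_ofReal {p q : ℝ} (hpq : p < q) {z : ℂ} :
    z ∈ segment ℝ (p : ℂ) (q : ℂ) ↔ z.im = 0 ∧ p ≤ z.re ∧ z.re ≤ q := by
  rw [segment_eq_image']
  constructor
  · rintro ⟨θ, hθ, rfl⟩
    simp only [Complex.add_im, Complex.ofReal_im, Complex.real_smul, Complex.mul_im,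
      Complex.ofReal_re, Complex.sub_im, Complex.sub_re, Complex.add_re, Complex.mul_re]
    refine ⟨by ring, by nlinarith [hθ.1], by nlinarith [hθ.2]⟩
  · rintro ⟨h1, h2, h3⟩
    refine ⟨(z.re - p) / (q - p), div_mem_Icc hpq ⟨h2, h3⟩, ?_⟩
    have : q - p ≠ 0 := by linarith
    apply Complex.ext
    · simp only [Complex.add_re, Complex.ofReal_re, Complex.real_smul, Complex.mul_re,
        Complex.sub_re, Complex.ofReal_im, Complex.sub_im]
      field_simp
      ring
    · rw [Complex.add_im, Complex.ofReal_im, Complex.real_smul, ← Complex.ofReal_sub,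
        Complex.im_ofReal_mul, Complex.ofReal_im, h1, mul_zero, add_zero]

/-- Affine parametrization of the segment from `p` to `q`. -/
noncomputable def segMap (p q : ℝ) (a b t : ℝ) : ℂ := ((p + (t - a) / (b - a) * (q - p) : ℝ) : ℂ)

theorem isGluing_segment {p q : ℝ} (hpq : p < q) {a b : ℝ} (hab : a < b) :
    IsGluing (segMap p q a b) (Icc a b) (segment ℝ (p : ℂ) q) (fun s t => s = t) := by
  have hba : b - a ≠ 0 := by linarith
  have hqp : q - p ≠ 0 := by linarith
  refine ⟨?_, ?_, ?_⟩
  · refine Continuous.continuousOn ?_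
    unfold segMap
    fun_prop
  · ext z
    rw [mem_segment_ofReal hpq]
    constructor
    · rintro ⟨t, ht, rfl⟩
      have := div_mem_Icc hab ht
      simp only [segMap, Complex.ofReal_im, Complex.ofReal_re, true_and]
      exact ⟨by nlinarith [this.1], by nlinarith [this.2]⟩
    · rintro ⟨h1, h2, h3⟩
      have := div_mem_Icc hpq ⟨h2, h3⟩
      refine ⟨a + (z.re - p) / (q - p) * (b - a), ⟨by nlinarith [this.1], by nlinarith [this.2]⟩, ?_⟩
      apply Complex.ext
      · simp only [segMap, Complex.ofReal_re]
        field_simp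
        ring
      · rw [segMap, Complex.ofReal_im, h1]
  · intro s _ t _
    rw [segMap, segMap, Complex.ofReal_inj, add_right_inj, mul_left_inj' hqp, div_left_inj' hba,
      sub_left_inj]

/-- Parametrization of the half-open segment from `1` to `2` by the half line from `a`. -/
noncomputable def halfOpenMap (a t : ℝ) : ℂ := ((1 + (t - a) / (1 + (t - a)) : ℝ) : ℂ)

theorem isGluing_halfOpen (a : ℝ) :
    IsGluing (halfOpenMap a) (Ici a) (segment ℝ (1 : ℂ) 2 \ {2}) (fun s t => s = t) := by
  refine ⟨?_, ?_, ?_⟩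
  · unfold halfOpenMap
    refine Complex.continuous_ofReal.comp_continuousOn (continuousOn_const.add
      (ContinuousOn.div (by fun_prop) (by fun_prop) fun t ht => ?_))
    have : a ≤ t := ht
    linarith
  · ext z
    have hseg := mem_segment_ofReal (p := 1) (q := 2) (by norm_num) (z := z)
    push_cast at hseg
    rw [mem_sdiff, hseg, mem_singleton_iff]
    constructor
    · rintro ⟨t, ht, rfl⟩
      have ht' : a ≤ t := ht
      have h1 : 0 ≤ (t - a) / (1 + (t - a)) := div_nonneg (by linarith) (by linarith)
      have h2 : (t - a) / (1 + (t - a)) < 1 := (div_lt_one (by linarith)).2 (by linarith)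
      refine ⟨⟨by rw [halfOpenMap, Complex.ofReal_im], ?_, ?_⟩, fun h => ?_⟩
      · simp only [halfOpenMap, Complex.ofReal_re]; linarith
      · simp only [halfOpenMap, Complex.ofReal_re]; linarith
      · have := congrArg Complex.re h
        simp only [halfOpenMap, Complex.ofReal_re, Complex.re_ofNat] at this
        linarith
    · rintro ⟨⟨h1, h2, h3⟩, h4⟩
      have h5 : z.re < 2 := lt_of_le_of_ne h3 fun h => h4 (Complex.ext (by simpa using h) (by simpa using h1))
      have h6 : 2 - z.re ≠ 0 := by linarith
      refine ⟨a + (z.re - 1) / (2 - z.re), ?_, ?_⟩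
      · have : 0 ≤ (z.re - 1) / (2 - z.re) := div_nonneg (by linarith) (by linarith)
        exact mem_Ici.2 (by linarith)
      · apply Complex.ext
        · have h7 : 1 + (z.re - 1) / (2 - z.re) = 1 / (2 - z.re) := by
            field_simp
            ring
          simp only [halfOpenMap, Complex.ofReal_re, add_sub_cancel_left, h7]
          field_simp
          ring
        · rw [halfOpenMap, Complex.ofReal_im, h1]
  · intro s hs t ht
    have hs' : 1 + (s - a) ≠ 0 := by have : a ≤ s := hs; linarith
    have ht' : 1 + (t - a) ≠ 0 := by have : a ≤ t := ht; linarith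
    rw [halfOpenMap, halfOpenMap, Complex.ofReal_inj, add_right_inj, div_eq_div_iff hs' ht']
    constructor
    · intro h; nlinarith
    · rintro rfl; rfl

theorem mem_sphere_ofReal {p : ℝ} {z : ℂ} :
    z ∈ Metric.sphere (p : ℂ) 1 ↔ (z.re - p) ^ 2 + z.im ^ 2 = 1 := by
  rw [mem_sphere_iff_norm, ← sq_eq_sq₀ (norm_nonneg _) zero_le_one, one_pow, Complex.sq_norm,
    Complex.normSq_apply]
  simp only [Complex.sub_re, Complex.ofReal_re, Complex.sub_im, Complex.ofReal_im, sub_zero]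
  rw [← sq, ← sq]

theorem eq_ofReal_of_mem_sphere {p : ℝ} {z : ℂ} (hz : z ∈ Metric.sphere (p : ℂ) 1) :
    (p + 1 ≤ z.re → z = ((p + 1 : ℝ) : ℂ)) ∧ (z.re ≤ p - 1 → z = ((p - 1 : ℝ) : ℂ)) := by
  rw [mem_sphere_ofReal] at hz
  constructor
  · intro h
    apply Complex.ext
    · simp only [Complex.ofReal_re]; nlinarith [sq_nonneg z.im]
    · simp only [Complex.ofReal_im]; nlinarith [sq_nonneg z.im]
  · intro h
    apply Complex.ext
    · simp only [Complex.ofReal_re]; nlinarith [sq_nonneg z.im]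
    · simp only [Complex.ofReal_im]; nlinarith [sq_nonneg z.im]

theorem re_le_of_mem_sphere {p : ℝ} {z : ℂ} (hz : z ∈ Metric.sphere (p : ℂ) 1) :
    p - 1 ≤ z.re ∧ z.re ≤ p + 1 := by
  rw [mem_sphere_ofReal] at hz
  constructor <;> nlinarith [sq_nonneg z.im]

theorem exists_isGluing_lollipop {a b c : ℝ} (hab : a < b) (hbc : b < c) :
    ∃ g, IsGluing g (Icc a c) lollipop
      (fun s t => s = t ∨ (s = a ∧ t = b) ∨ (s = b ∧ t = a)) := by
  have h1 := isGluing_circle ((0 : ℝ) : ℂ) (ε := 1) (by simp) hab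
  have h2 := isGluing_segment (p := 1) (q := 2) (by norm_num) hbc
  have e1 := circleMap'_right ((0 : ℝ) : ℂ) 1 hab
  have h := h1.glue h2 (b := b) isClosed_Icc isClosed_Icc (fun t ht => ht.2) (fun t ht => ht.1)
    (right_mem_Icc.2 hab.le) (left_mem_Icc.2 hbc.le) (by rw [e1]; simp [segMap]) (by
      rw [e1]
      rintro z ⟨hz1, hz2⟩
      have hz3 := (eq_ofReal_of_mem_sphere hz1).1
        (by have := ((mem_segment_ofReal (by norm_num)).1 hz2).2.1; linarith)
      rw [mem_singleton_iff, hz3]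
      simp)
  rw [Icc_union_Icc_eq_Icc hab.le hbc.le] at h
  have hS : Metric.sphere ((0 : ℝ) : ℂ) 1 ∪ segment ℝ ((1 : ℝ) : ℂ) (2 : ℝ) = lollipop := by
    simp [lollipop]
  rw [hS] at h
  refine ⟨_, h.congr fun s hs t ht => ?_⟩
  simp only [glueRel]
  grind

/-- The formula on the stem is kept because it is needed later to show that the map is proper. -/
theorem exists_isGluing_openLollipop {a b : ℝ} (hab : a < b) :
    ∃ g, IsGluing g (Ici a) openLollipop
      (fun s t => s = t ∨ (s = a ∧ t = b) ∨ (s = b ∧ t = a)) ∧ ∀ t, b ≤ t → g t = halfOpenMap b t := by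
  have h1 := isGluing_circle ((0 : ℝ) : ℂ) (ε := 1) (by simp) hab
  have h2 := isGluing_halfOpen b
  have e1 := circleMap'_right ((0 : ℝ) : ℂ) 1 hab
  have hb : circleMap' ((0 : ℝ) : ℂ) 1 a b b = halfOpenMap b b := by
    rw [e1]; simp [halfOpenMap]
  have h := h1.glue h2 (b := b) isClosed_Icc isClosed_Ici (fun t ht => ht.2) (fun t ht => ht)
    (right_mem_Icc.2 hab.le) self_mem_Ici hb (by
      rw [e1]
      rintro z ⟨hz1, hz2, -⟩
      have hseg := mem_segment_ofReal (p := 1) (q := 2) (by norm_num) (z := z)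
      push_cast at hseg
      have hz3 := (eq_ofReal_of_mem_sphere hz1).1
        (by have := (hseg.1 hz2).2.1; linarith)
      rw [mem_singleton_iff, hz3]
      simp)
  rw [Icc_union_Ici_eq_Ici hab.le] at h
  have hS : Metric.sphere ((0 : ℝ) : ℂ) 1 ∪ segment ℝ (1 : ℂ) 2 \ {2} = openLollipop := by
    rw [openLollipop, lollipop, union_sdiff_distrib]
    congr 1
    rw [eq_comm, Complex.ofReal_zero, sdiff_eq_left, disjoint_singleton_right]
    simp
  rw [hS] at h
  refine ⟨_, h.congr fun s hs t ht => ?_, fun t ht => ?_⟩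
  · simp only [glueRel]
    grind
  · rcases eq_or_lt_of_le ht with rfl | ht
    · simpa using hb
    · simp [not_le.2 ht]

theorem exists_isGluing_figureEight {a b c : ℝ} (hab : a < b) (hbc : b < c) :
    ∃ g, IsGluing g (Icc a c) figureEight
      (fun s t => s = t ∨ ((s = a ∨ s = b ∨ s = c) ∧ (t = a ∨ t = b ∨ t = c))) := by
  have h1 := isGluing_circle ((-1 : ℝ) : ℂ) (ε := 1) (by simp) hab
  -- The signs of `ε` base both circles at their common point `0`.
  have h2 := isGluing_circle ((1 : ℝ) : ℂ) (ε := -1) (by simp) hbc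
  have e1 := circleMap'_right ((-1 : ℝ) : ℂ) 1 hab
  have e2 := circleMap'_left ((1 : ℝ) : ℂ) (-1) b c
  have h := h1.glue h2 (b := b) isClosed_Icc isClosed_Icc (fun t ht => ht.2) (fun t ht => ht.1)
    (right_mem_Icc.2 hab.le) (left_mem_Icc.2 hbc.le) (by rw [e1, e2]; simp) (by
      rw [e1]
      rintro z ⟨hz1, hz2⟩
      have hz3 := (eq_ofReal_of_mem_sphere hz1).1
        (by have := (re_le_of_mem_sphere hz2).1; linarith)
      rw [mem_singleton_iff, hz3]
      simp)
  rw [Icc_union_Icc_eq_Icc hab.le hbc.le] at h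
  have hS : Metric.sphere ((-1 : ℝ) : ℂ) 1 ∪ Metric.sphere ((1 : ℝ) : ℂ) 1 = figureEight := by
    simp [figureEight]
  rw [hS] at h
  refine ⟨_, h.congr fun s hs t ht => ?_⟩
  simp only [glueRel]
  grind

theorem exists_isGluing_dumbbell {a b c d : ℝ} (hab : a < b) (hbc : b < c) (hcd : c < d) :
    ∃ g, IsGluing g (Icc a d) dumbbell
      (fun s t => s = t ∨ (s = a ∧ t = b) ∨ (s = b ∧ t = a) ∨ (s = c ∧ t = d) ∨
        (s = d ∧ t = c)) := by
  have h1 := isGluing_circle ((-2 : ℝ) : ℂ) (ε := 1) (by simp) hab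
  have h2 := isGluing_segment (p := -1) (q := 1) (by norm_num) hbc
  have h3 := isGluing_circle ((2 : ℝ) : ℂ) (ε := -1) (by simp) hcd
  have e1 := circleMap'_right ((-2 : ℝ) : ℂ) 1 hab
  have e3 := circleMap'_left ((2 : ℝ) : ℂ) (-1) c d
  have hcb : c - b ≠ 0 := by linarith
  have h12 := h1.glue h2 (b := b) isClosed_Icc isClosed_Icc (fun t ht => ht.2) (fun t ht => ht.1)
    (right_mem_Icc.2 hab.le) (left_mem_Icc.2 hbc.le)
    (by rw [e1]; simp only [segMap]; push_cast; simp; norm_num) (by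
      rw [e1]
      rintro z ⟨hz1, hz2⟩
      have hz3 := (eq_ofReal_of_mem_sphere hz1).1
        (by have := ((mem_segment_ofReal (by norm_num)).1 hz2).2.1; linarith)
      rw [mem_singleton_iff, hz3]
      push_cast
      rfl)
  rw [Icc_union_Icc_eq_Icc hab.le hbc.le] at h12
  have e12 : (if c ≤ b then circleMap' ((-2 : ℝ) : ℂ) 1 a b c else segMap (-1) 1 b c c) = 1 := by
    rw [if_neg (not_le.2 hbc), segMap, div_self hcb]
    norm_num
  have h := h12.glue h3 (b := c) isClosed_Icc isClosed_Icc (fun t ht => ht.2) (fun t ht => ht.1)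
    (right_mem_Icc.2 (hab.trans hbc).le) (left_mem_Icc.2 hcd.le)
    (by rw [e12, e3]; push_cast; norm_num) (by
      rw [e12]
      rintro z ⟨hz1, hz2⟩
      have hz3 : z.re ≤ 1 := by
        rcases hz1 with hz1 | hz1
        · have := (re_le_of_mem_sphere hz1).2
          linarith
        · exact ((mem_segment_ofReal (by norm_num)).1 hz1).2.2
      have hz4 := (eq_ofReal_of_mem_sphere hz2).2 (by linarith)
      rw [mem_singleton_iff, hz4]
      push_cast
      norm_num)
  rw [Icc_union_Icc_eq_Icc (hab.trans hbc).le hcd.le] at h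
  have hS : Metric.sphere ((-2 : ℝ) : ℂ) 1 ∪ segment ℝ ((-1 : ℝ) : ℂ) (1 : ℝ) ∪
      Metric.sphere ((2 : ℝ) : ℂ) 1 = dumbbell := by
    simp [dumbbell]
  rw [hS] at h
  refine ⟨_, h.congr fun s hs t ht => ?_⟩
  simp only [glueRel]
  grind

end Shapes

/-! ### The listed spaces are `n`-ac -/

section Backward

/-- `f` need not be a homeomorphism: it is one onto its image on each compact subinterval, as `X` is
Hausdorff, and finitely many points lie over such a subinterval. -/
theorem isArcConnected_of_bijective {X : Type*} [TopologicalSpace X] [T2Space X] {J : Set ℝ}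
    (hJ : OrdConnected J) {a b : ℝ} (ha : a ∈ J) (hb : b ∈ J) (hab : a < b) {f : J → X}
    (hf : Continuous f) (hbij : Function.Bijective f) (n : ℕ) : IsArcConnected n X := by
  classical
  intro S _
  choose g hg using hbij.2
  -- Adding `a` and `b` keeps the subinterval nondegenerate.
  let T : Finset ℝ := insert a (insert b (S.image fun p => (g p : ℝ)))
  have hTJ : ∀ t ∈ T, t ∈ J := by
    intro t ht
    simp only [T, Finset.mem_insert, Finset.mem_image] at ht
    rcases ht with rfl | rfl | ⟨p, -, rfl⟩
    exacts [ha, hb, (g p).2]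
  have hne : T.Nonempty := ⟨a, by simp [T]⟩
  have hlt : T.min' hne < T.max' hne :=
    (T.min'_le a (by simp [T])).trans_lt (hab.trans_le (T.le_max' b (by simp [T])))
  have hsub : Icc (T.min' hne) (T.max' hne) ⊆ J :=
    hJ.out (hTJ _ (T.min'_mem hne)) (hTJ _ (T.max'_mem hne))
  let h : unitInterval → X := f ∘ inclusion hsub ∘ (iccHomeoI _ _ hlt).symm
  have hc : Continuous h := hf.comp ((continuous_inclusion hsub).comp (Homeomorph.continuous _))
  have hi : Function.Injective h :=
    hbij.1.comp ((inclusion_injective hsub).comp (Homeomorph.injective _))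
  refine ⟨range h, ⟨(hc.isClosedEmbedding hi).isEmbedding.toHomeomorph⟩, fun p hp => ?_⟩
  have hgp : (g p : ℝ) ∈ T := by
    simp only [T, Finset.mem_insert, Finset.mem_image]
    exact Or.inr (Or.inr ⟨p, hp, rfl⟩)
  refine ⟨iccHomeoI _ _ hlt ⟨g p, T.min'_le _ hgp, T.le_max' _ hgp⟩, ?_⟩
  simp only [h, Function.comp_apply, Homeomorph.symm_apply_apply]
  exact hg p

theorem isArcConnected_of_homeomorph {X Y : Type*} [TopologicalSpace X] [TopologicalSpace Y]
    [T2Space Y] (h : X ≃ₜ Y) {J : Set ℝ}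
    (hJ : OrdConnected J) {a b : ℝ} (ha : a ∈ J) (hb : b ∈ J) (hab : a < b) {f : J → Y}
    (hf : Continuous f) (hbij : Function.Bijective f) (n : ℕ) : IsArcConnected n X := by
  have : T2Space X := h.isEmbedding.t2Space
  exact isArcConnected_of_bijective hJ ha hb hab (f := h.symm ∘ f)
    (h.symm.continuous.comp hf) (h.symm.bijective.comp hbij) n

/-- `J` is a subinterval of `K` that meets each class of identified points exactly once. -/
theorem IsGluing.isArcConnected {g : ℝ → ℂ} {K : Set ℝ} {S : Set ℂ} {r : ℝ → ℝ → Prop}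
    (h : IsGluing g K S r) {X : Type*} [TopologicalSpace X] (e : X ≃ₜ S) {J : Set ℝ}
    (hJ : OrdConnected J) (hJK : J ⊆ K) {a b : ℝ} (ha : a ∈ J) (hb : b ∈ J) (hab : a < b)
    (hinj : ∀ s ∈ J, ∀ t ∈ J, r s t → s = t) (hsurj : ∀ s ∈ K, ∃ t ∈ J, r s t) (n : ℕ) :
    IsArcConnected n X := by
  have hmaps : ∀ t : J, g t ∈ S := fun t => h.image ▸ mem_image_of_mem _ (hJK t.2)
  refine isArcConnected_of_homeomorph e hJ ha hb hab (f := fun t => ⟨g t, hmaps t⟩) ?_ ⟨?_, ?_⟩ n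
  · exact Continuous.subtype_mk (continuousOn_iff_continuous_domRestrict.1 (h.cont.mono hJK)) _
  · rintro ⟨s, hs⟩ ⟨t, ht⟩ hst
    rw [Subtype.mk.injEq, h.ker s (hJK hs) t (hJK ht)] at hst
    exact Subtype.ext (hinj s hs t ht hst)
  · rintro ⟨p, hp⟩
    rw [← h.image] at hp
    obtain ⟨s, hs, rfl⟩ := hp
    obtain ⟨t, ht, hst⟩ := hsurj s hs
    exact ⟨⟨t, ht⟩, Subtype.ext ((h.ker s hs t (hJK ht)).2 hst).symm⟩

end Backward

/-! ### The planar models as quotients of intervals -/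

section Quotients

theorem IsGluing.exists_isQuotientMap {g : ℝ → ℂ} {K : Set ℝ} {S : Set ℂ} {r : ℝ → ℝ → Prop}
    (h : IsGluing g K S r)
    (hq : ∀ q : K → S, Continuous q → (∀ t, (q t : ℂ) = g t) → IsClosedMap q) :
    ∃ q : K → S, IsQuotientMap q ∧ ∀ s t : K, q s = q t ↔ r s t := by
  have hmaps : ∀ t : K, g t ∈ S := fun t => h.image ▸ mem_image_of_mem _ t.2
  have hc : Continuous fun t : K => (⟨g t, hmaps t⟩ : S) :=
    Continuous.subtype_mk (continuousOn_iff_continuous_domRestrict.1 h.cont) _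
  refine ⟨fun t => ⟨g t, hmaps t⟩, (hq _ hc fun _ => rfl).isQuotientMap hc ?_, fun s t => ?_⟩
  · rintro ⟨p, hp⟩
    have hp' := hp
    rw [← h.image] at hp'
    obtain ⟨s, hs, hsp⟩ := hp'
    exact ⟨⟨s, hs⟩, Subtype.ext hsp⟩
  · rw [Subtype.mk.injEq]
    exact h.ker s s.2 t t.2

theorem IsGluing.exists_isQuotientMap_of_compact {g : ℝ → ℂ} {a b : ℝ} {S : Set ℂ}
    {r : ℝ → ℝ → Prop} (h : IsGluing g (Icc a b) S r) :
    ∃ q : Icc a b → S, IsQuotientMap q ∧ ∀ s t : Icc a b, q s = q t ↔ r s t :=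
  h.exists_isQuotientMap fun _ hc _ => hc.isClosedMap

theorem isClosed_lollipop : IsClosed lollipop :=
  Metric.isClosed_sphere.union (by
    rw [segment_eq_image']
    exact (isCompact_Icc.image (by fun_prop)).isClosed)

theorem re_lt_two_of_mem_openLollipop {z : ℂ} (hz : z ∈ openLollipop) : z.re < 2 := by
  obtain ⟨hz1 | hz1, hz2⟩ := hz
  · have := (re_le_of_mem_sphere (p := 0) (by simpa using hz1)).2
    linarith
  · have hseg := mem_segment_ofReal (p := 1) (q := 2) (by norm_num) (z := z)
    push_cast at hseg
    obtain ⟨h1, h2, h3⟩ := hseg.1 hz1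
    exact lt_of_le_of_ne h3 fun h => hz2 (Complex.ext (by simpa using h) (by simpa using h1))

theorem exists_isQuotientMap_openLollipop {a b : ℝ} (hab : a < b) :
    ∃ q : Ici a → openLollipop, IsQuotientMap q ∧ ∀ s t : Ici a, q s = q t ↔
      ((s : ℝ) = t ∨ ((s : ℝ) = a ∧ (t : ℝ) = b) ∨ ((s : ℝ) = b ∧ (t : ℝ) = a)) := by
  obtain ⟨g, hg, hgb⟩ := exists_isGluing_openLollipop hab
  refine hg.exists_isQuotientMap fun q hc hqg => ?_
  have hloc : LocallyCompactSpace openLollipop := by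
    refine IsLocallyClosed.locallyCompactSpace ?_
    rw [openLollipop, sdiff_eq]
    exact isClosed_lollipop.isLocallyClosed.inter isOpen_compl_singleton.isLocallyClosed
  -- `Ici a` is not compact, so closedness comes from properness: on a compact `C` the real part has
  -- a maximum below `2`, while along the stem it tends to `2`, so the preimage of `C` is bounded.
  refine (isProperMap_iff_isCompact_preimage.2 ⟨hc, fun C hC => ?_⟩).isClosedMap
  have hcl : IsClosed (q ⁻¹' C) := hC.isClosed.preimage hc
  rcases C.eq_empty_or_nonempty with rfl | hne
  · simp
  obtain ⟨p, -, hp⟩ := hC.exists_isMaxOn hne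
    (Complex.continuous_re.comp continuous_subtype_val).continuousOn
  have hp2 := re_lt_two_of_mem_openLollipop p.2
  obtain ⟨R, hRb, hR⟩ : ∃ R, b ≤ R ∧ ∀ t, R < t → (p : ℂ).re < (halfOpenMap b t).re := by
    refine ⟨b + 1 / (2 - (p : ℂ).re), ?_, fun t ht => ?_⟩
    · have : 0 < 1 / (2 - (p : ℂ).re) := by
        apply div_pos one_pos; linarith
      linarith
    · have h0 : 0 < 2 - (p : ℂ).re := by linarith
      have h1 : 1 / (2 - (p : ℂ).re) < t - b := by linarith
      have h2 : 0 < t - b := lt_trans (by positivity) h1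
      have h3 : 1 < (t - b) * (2 - (p : ℂ).re) := by rwa [div_lt_iff₀ h0] at h1
      have h4 : (t - b) / (1 + (t - b)) = 1 - 1 / (1 + (t - b)) := by
        field_simp
        ring
      have h5 : 1 / (1 + (t - b)) < 2 - (p : ℂ).re := by
        rw [div_lt_iff₀ (by linarith)]
        nlinarith
      simp only [halfOpenMap, Complex.ofReal_re]
      linarith
  have hsub : q ⁻¹' C ⊆ Subtype.val ⁻¹' Icc a R := by
    intro t ht
    refine ⟨t.2, ?_⟩
    by_contra hlt
    push Not at hlt
    have h1 := hR t hlt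
    have h2 : ((q t : ℂ)).re ≤ (p : ℂ).re := hp ht
    rw [hqg, hgb t (by linarith)] at h2
    linarith
  refine IsCompact.of_isClosed_subset ?_ hcl hsub
  exact isClosed_Ici.isClosedEmbedding_subtypeVal.isCompact_preimage isCompact_Icc

end Quotients

/-! ### Joining two sides along the real line -/

section Sides

variable {V : Type*} {G H HA HB : SimpleGraph V} {w : V}

/-- `H` is traversed by the `x i` for `i ∈ D`, whose only coincidences are those given by `P`. -/
structure IsSide (H : SimpleGraph V) (x : ℕ → V) (D : Set ℕ) (P : ℕ → ℕ → Prop) : Prop where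
  zero : 0 ∈ D
  down : ∀ i, i + 1 ∈ D → i ∈ D
  adj : ∀ i, i + 1 ∈ D → H.Adj (x i) (x (i + 1))
  edge : ∀ e ∈ H.edgeSet, ∃ i, i + 1 ∈ D ∧ e = s(x i, x (i + 1))
  inj : ∀ i j, i + 1 ∈ D → j + 1 ∈ D → s(x i, x (i + 1)) = s(x j, x (j + 1)) → i = j
  ker : ∀ i ∈ D, ∀ j ∈ D, x i = x j ↔ i = j ∨ P i j ∨ P j i
  mem : ∀ i j, P i j → i ∈ D ∧ j ∈ D ∧ i < j

theorem IsRaySeq.isSide {x : ℕ → V} (h : IsRaySeq H x) :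
    IsSide H x univ (fun _ _ => False) := by
  refine ⟨trivial, fun _ _ => trivial, fun i _ => h.adj i, fun e he => ?_, ?_, ?_, ?_⟩
  · obtain ⟨i, hi⟩ := h.edge e he
    exact ⟨i, trivial, hi⟩
  · intro i j _ _ hij
    rcases Sym2.eq_iff.1 hij with ⟨h1, -⟩ | ⟨h1, h2⟩
    · exact h.inj h1
    · have := h.inj h1
      have := h.inj h2
      omega
  · intro i _ j _
    simp [h.inj.eq_iff]
  · exact fun _ _ h => h.elim

theorem IsPathSeq.isSide {x : ℕ → V} {N : ℕ} (h : IsPathSeq H x N) :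
    IsSide H x (Iic N) (fun _ _ => False) := by
  refine ⟨by simp, fun i hi => ?_, fun i hi => h.adj i hi, fun e he => ?_, ?_, ?_, ?_⟩
  · simp only [mem_Iic] at hi ⊢; omega
  · obtain ⟨i, hi, hi'⟩ := h.edge e he
    exact ⟨i, hi, hi'⟩
  · intro i j hi hj hij
    simp only [mem_Iic] at hi hj
    rcases Sym2.eq_iff.1 hij with ⟨h1, -⟩ | ⟨h1, h2⟩
    · exact h.inj _ _ (by omega) (by omega) h1
    · have := h.inj _ _ (by omega) (by omega) h1
      have := h.inj _ _ (by omega) (by omega) h2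
      omega
  · intro i hi j hj
    simp only [or_false]
    exact ⟨h.inj _ _ hi hj, fun h => h ▸ rfl⟩
  · exact fun _ _ h => h.elim

theorem IsLassoSeq.isSide {x : ℕ → V} {m N : ℕ} (h : IsLassoSeq H x m N) :
    IsSide H x (Iic N) (fun i j => i = m ∧ j = N) := by
  have hlt := h.lt
  have ker : ∀ i ≤ N, ∀ j ≤ N, x i = x j ↔ i = j ∨ (i = m ∧ j = N) ∨ (j = m ∧ i = N) := by
    intro i hi j hj
    constructor
    · intro hij
      rcases hi.eq_or_lt with rfl | hi' <;> rcases hj.eq_or_lt with rfl | hj'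
      · exact Or.inl rfl
      · rw [h.closed] at hij
        exact Or.inr (Or.inr ⟨(h.inj _ _ (by omega) hj' hij).symm, rfl⟩)
      · rw [h.closed] at hij
        exact Or.inr (Or.inl ⟨h.inj _ _ hi' (by omega) hij, rfl⟩)
      · exact Or.inl (h.inj _ _ hi' hj' hij)
    · rintro (rfl | ⟨rfl, rfl⟩ | ⟨rfl, rfl⟩)
      · rfl
      · exact h.closed.symm
      · exact h.closed
  refine ⟨by simp, fun i hi => ?_, fun i hi => h.adj i hi, fun e he => ?_, ?_, ?_, ?_⟩
  · simp only [mem_Iic] at hi ⊢; omega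
  · obtain ⟨i, hi, hi'⟩ := h.edge e he
    exact ⟨i, hi, hi'⟩
  · intro i j hi hj hij
    simp only [mem_Iic] at hi hj
    rcases Sym2.eq_iff.1 hij with ⟨h1, -⟩ | ⟨h1, h2⟩
    · rw [ker _ (by omega) _ (by omega)] at h1
      omega
    -- Here `m + 2 < N` is needed: a cycle of length two would run through the same edge twice.
    · rw [ker _ (by omega) _ (by omega)] at h1 h2
      omega
  · exact ker
  · rintro i j ⟨rfl, rfl⟩
    simp only [mem_Iic]
    omega

/-- The identifications on the line made by two sides with coincidences `PA` and `PB`. -/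
def SplitRel (PA PB : ℕ → ℕ → Prop) (s t : ℝ) : Prop :=
  s = t ∨
    (∃ i j : ℕ, PA i j ∧ ((s = i ∧ t = j) ∨ (s = j ∧ t = i))) ∨
    (∃ i j : ℕ, PB i j ∧ ((s = -i ∧ t = -j) ∨ (s = -j ∧ t = -i))) ∨
    ∃ i j : ℕ, PA 0 i ∧ PB 0 j ∧ ((s = i ∧ t = -j) ∨ (s = -j ∧ t = i))

/-- Two sides joined at the root `w` give a parametrization of `|G|`. -/
theorem IsSplit.exists_isQuotientMap (h : IsSplit G HA HB w) (hiso : ∀ v : V, ∃ u, G.Adj v u)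
    {xA xB : ℕ → V} {DA DB : Set ℕ} {PA PB : ℕ → ℕ → Prop} (hA : IsSide HA xA DA PA)
    (hB : IsSide HB xB DB PB) (hA0 : xA 0 = w) (hB0 : xB 0 = w) {K : Set ℝ} (hK : IsClosed K)
    (hfloor : ∀ t ∈ K, ((⌊t⌋ : ℤ) : ℝ) ∈ K) (hceil : ∀ t ∈ K, ((⌈t⌉ : ℤ) : ℝ) ∈ K)
    (hord : OrdConnected K) (hKA : ∀ i : ℕ, (i : ℝ) ∈ K ↔ i ∈ DA)
    (hKB : ∀ i : ℕ, -(i : ℝ) ∈ K ↔ i ∈ DB) :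
    ∃ φ : K → Complex G, IsQuotientMap φ ∧ ∀ s t : K, φ s = φ t ↔ SplitRel PA PB s t := by
  -- One side is laid along the nonnegative integers, the other along the nonpositive ones, with `w`
  -- at `0`.
  set z : ℤ → V := fun k => if 0 ≤ k then xA k.toNat else xB (-k).toNat with hz
  have hzA : ∀ i : ℕ, z i = xA i := fun i => by simp [hz]
  have hzB : ∀ i : ℕ, z (-i) = xB i := fun i => by
    rcases Nat.eq_zero_or_pos i with rfl | hi
    · simp [hz, hA0, hB0]
    · simp only [hz]
      rw [if_neg (by omega)]
      simp
  have hzB' : ∀ i : ℕ, z (-((i + 1 : ℕ) : ℤ) + 1) = xB i := fun i => by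
    rw [← hzB]; congr 1; push_cast; ring
  have hcases : ∀ k : ℤ, (k : ℝ) ∈ K → ((k + 1 : ℤ) : ℝ) ∈ K →
      (∃ i : ℕ, k = i ∧ i + 1 ∈ DA) ∨ ∃ i : ℕ, k = -((i + 1 : ℕ) : ℤ) ∧ i + 1 ∈ DB := by
    intro k h1 h2
    rcases le_or_gt 0 k with hk | hk
    · obtain ⟨i, rfl⟩ := Int.eq_ofNat_of_zero_le hk
      refine Or.inl ⟨i, rfl, (hKA (i + 1)).1 ?_⟩
      push_cast at h2 ⊢
      exact h2
    · obtain ⟨i, rfl⟩ : ∃ i : ℕ, k = -((i + 1 : ℕ) : ℤ) := ⟨(-k - 1).toNat, by omega⟩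
      refine Or.inr ⟨i, rfl, (hKB (i + 1)).1 ?_⟩
      push_cast at h1 ⊢
      exact h1
  have hmemA : ∀ i : ℕ, i + 1 ∈ DA → ((i : ℤ) : ℝ) ∈ K ∧ (((i : ℤ) + 1 : ℤ) : ℝ) ∈ K := by
    intro i hi
    refine ⟨?_, ?_⟩
    · rw [Int.cast_natCast, hKA]; exact hA.down i hi
    · have := (hKA (i + 1)).2 hi
      push_cast at this ⊢
      exact this
  have hmemB : ∀ i : ℕ, i + 1 ∈ DB → ((-((i + 1 : ℕ) : ℤ) : ℤ) : ℝ) ∈ K ∧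
      ((-((i + 1 : ℕ) : ℤ) + 1 : ℤ) : ℝ) ∈ K := by
    intro i hi
    refine ⟨?_, ?_⟩
    · have := (hKB (i + 1)).2 hi
      push_cast at this ⊢
      exact this
    · have := (hKB i).2 (hB.down i hi)
      push_cast
      rwa [show -((i : ℝ) + 1) + 1 = -i by ring]
  have hadjA : ∀ i, i ∈ DA → 0 < i → ∃ a, HA.Adj (xA i) a := fun i hi h0 => by
    obtain ⟨k, rfl⟩ : ∃ k, i = k + 1 := ⟨i - 1, by omega⟩
    exact ⟨_, (hA.adj k hi).symm⟩
  have hadjB : ∀ i, i ∈ DB → 0 < i → ∃ a, HB.Adj (xB i) a := fun i hi h0 => by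
    obtain ⟨k, rfl⟩ : ∃ k, i = k + 1 := ⟨i - 1, by omega⟩
    exact ⟨_, (hB.adj k hi).symm⟩
  have hedge : ∀ e ∈ G.edgeSet, ∃ k : ℤ, (k : ℝ) ∈ K ∧ ((k + 1 : ℤ) : ℝ) ∈ K ∧
      e = s(z k, z (k + 1)) := by
    intro e he
    have : e ∈ HA.edgeSet ∨ e ∈ HB.edgeSet := by
      induction e with | _ a b => exact (h.adj a b).1 he
    rcases this with he' | he'
    · obtain ⟨i, hi, rfl⟩ := hA.edge e he'
      refine ⟨i, (hmemA i hi).1, (hmemA i hi).2, ?_⟩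
      rw [hzA, ← hzA (i + 1)]
      push_cast
      rfl
    · obtain ⟨i, hi, rfl⟩ := hB.edge e he'
      refine ⟨_, (hmemB i hi).1, (hmemB i hi).2, ?_⟩
      rw [hzB, hzB', Sym2.eq_swap]
  have hadj : ∀ k : ℤ, (k : ℝ) ∈ K → ((k + 1 : ℤ) : ℝ) ∈ K →
      (∃ i : ℕ, k = i ∧ i + 1 ∈ DA ∧ s(z k, z (k + 1)) = s(xA i, xA (i + 1))) ∨
      ∃ i : ℕ, k = -((i + 1 : ℕ) : ℤ) ∧ i + 1 ∈ DB ∧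
        s(z k, z (k + 1)) = s(xB i, xB (i + 1)) := by
    intro k h1 h2
    rcases hcases k h1 h2 with ⟨i, rfl, hi⟩ | ⟨i, rfl, hi⟩
    · refine Or.inl ⟨i, rfl, hi, ?_⟩
      rw [hzA, ← hzA (i + 1)]
      push_cast
      rfl
    · refine Or.inr ⟨i, rfl, hi, ?_⟩
      rw [hzB, hzB', Sym2.eq_swap]
  have htrav : IsTraversal G z K := by
    refine ⟨hK, hfloor, hceil, hord, fun k h1 h2 => ?_, hedge, fun k l h1 h2 h3 h4 hkl => ?_,
      fun v => ?_⟩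
    · rw [← SimpleGraph.mem_edgeSet]
      rcases hadj k h1 h2 with ⟨i, -, hi, he⟩ | ⟨i, -, hi, he⟩
      · rw [he]; exact (h.adj _ _).2 (Or.inl (hA.adj i hi))
      · rw [he]; exact (h.adj _ _).2 (Or.inr (hB.adj i hi))
    · have hdisj : ∀ a b c d, HA.Adj a b → HB.Adj c d → s(a, b) ≠ s(c, d) := by
        intro a b c d h1 h2 h3
        rw [← SimpleGraph.mem_edgeSet] at h2
        rw [← h3] at h2
        exact h.not_both h1 h2
      rcases hadj k h1 h2 with ⟨i, rfl, hi, he⟩ | ⟨i, rfl, hi, he⟩ <;>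
        rcases hadj l h3 h4 with ⟨j, rfl, hj, he'⟩ | ⟨j, rfl, hj, he'⟩ <;> rw [he, he'] at hkl
      · rw [hA.inj i j hi hj hkl]
      · exact absurd hkl (hdisj _ _ _ _ (hA.adj i hi) (hB.adj j hj))
      · exact absurd hkl.symm (hdisj _ _ _ _ (hA.adj j hj) (hB.adj i hi))
      · rw [hB.inj i j hi hj hkl]
    · obtain ⟨u, hu⟩ := hiso v
      obtain ⟨k, h1, h2, he⟩ := hedge s(v, u) hu
      rcases Sym2.eq_iff.1 he with ⟨h3, -⟩ | ⟨h3, -⟩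
      · exact ⟨k, h1, h3⟩
      · exact ⟨k + 1, h2, h3⟩
  obtain ⟨φ, hφ, hker⟩ := htrav.exists_isQuotientMap
  refine ⟨φ, hφ, ?_⟩
  -- A vertex common to both sides is `w`, so each index is `0` or the place where its side returns
  -- to the root.
  have hcross : ∀ i ∈ DA, ∀ j ∈ DB, xA i = xB j →
      i = 0 ∧ j = 0 ∨ PA 0 i ∧ j = 0 ∨ i = 0 ∧ PB 0 j ∨ PA 0 i ∧ PB 0 j := by
    intro i hi j hj hij
    have hw : xA i = xA 0 ∧ xB j = xB 0 := by
      rw [hA0, hB0, ← hij, and_self]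
      rcases Nat.eq_zero_or_pos i with rfl | h1
      · exact hA0
      rcases Nat.eq_zero_or_pos j with rfl | h2
      · rw [hij, hB0]
      obtain ⟨a, ha⟩ := hadjA i hi h1
      obtain ⟨b, hb⟩ := hadjB j hj h2
      exact h.eq _ _ _ ha (hij ▸ hb)
    have h1 := (hA.ker i hi 0 hA.zero).1 hw.1
    have h2 := (hB.ker j hj 0 hB.zero).1 hw.2
    have h3 : ¬ PA i 0 := fun h => by have := (hA.mem _ _ h).2.2; omega
    have h4 : ¬ PB j 0 := fun h => by have := (hB.mem _ _ h).2.2; omega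
    tauto
  rintro ⟨s, hs⟩ ⟨t, ht⟩
  rw [hker]
  simp only [Subtype.mk.injEq, SplitRel]
  constructor
  · rintro (rfl | ⟨k, l, rfl, rfl, hkl⟩)
    · exact Or.inl rfl
    obtain ⟨i, rfl | rfl⟩ := k.eq_nat_or_neg <;> obtain ⟨j, rfl | rfl⟩ := l.eq_nat_or_neg
    all_goals
      simp only [hzA, hzB] at hkl
      push_cast at hs ht ⊢
      simp only [hKA, hKB] at hs ht
    · rcases (hA.ker i hs j ht).1 hkl with rfl | h1 | h1
      · exact Or.inl rfl
      · exact Or.inr (Or.inl ⟨i, j, h1, Or.inl ⟨rfl, rfl⟩⟩)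
      · exact Or.inr (Or.inl ⟨j, i, h1, Or.inr ⟨rfl, rfl⟩⟩)
    · rcases hcross i hs j ht hkl with ⟨rfl, rfl⟩ | ⟨h1, rfl⟩ | ⟨rfl, h1⟩ | ⟨h1, h2⟩
      · exact Or.inl (by simp)
      · exact Or.inr (Or.inl ⟨0, i, h1, Or.inr ⟨rfl, by simp⟩⟩)
      · exact Or.inr (Or.inr (Or.inl ⟨0, j, h1, Or.inl ⟨by simp, rfl⟩⟩))
      · exact Or.inr (Or.inr (Or.inr ⟨i, j, h1, h2, Or.inl ⟨rfl, rfl⟩⟩))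
    · rcases hcross j ht i hs hkl.symm with ⟨rfl, rfl⟩ | ⟨h1, rfl⟩ | ⟨rfl, h1⟩ | ⟨h1, h2⟩
      · exact Or.inl (by simp)
      · exact Or.inr (Or.inl ⟨0, j, h1, Or.inl ⟨by simp, rfl⟩⟩)
      · exact Or.inr (Or.inr (Or.inl ⟨0, i, h1, Or.inr ⟨rfl, by simp⟩⟩))
      · exact Or.inr (Or.inr (Or.inr ⟨j, i, h1, h2, Or.inr ⟨rfl, rfl⟩⟩))
    · rcases (hB.ker i hs j ht).1 hkl with rfl | h1 | h1
      · exact Or.inl rfl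
      · exact Or.inr (Or.inr (Or.inl ⟨i, j, h1, Or.inl ⟨rfl, rfl⟩⟩))
      · exact Or.inr (Or.inr (Or.inl ⟨j, i, h1, Or.inr ⟨rfl, rfl⟩⟩))
  · have eA : ∀ i j, PA i j → z i = z j := fun i j hP => by
      rw [hzA, hzA]
      exact (hA.ker i (hA.mem i j hP).1 j (hA.mem i j hP).2.1).2 (Or.inr (Or.inl hP))
    have eB : ∀ i j, PB i j → z (-i) = z (-j) := fun i j hP => by
      rw [hzB, hzB]
      exact (hB.ker i (hB.mem i j hP).1 j (hB.mem i j hP).2.1).2 (Or.inr (Or.inl hP))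
    have e0 : ∀ i j, PA 0 i → PB 0 j → z i = z (-j) := fun i j h1 h2 => by
      rw [← eA 0 i h1, ← eB 0 j h2]
      simp
    rintro (h1 | ⟨i, j, hP, ⟨h1, h2⟩ | ⟨h1, h2⟩⟩ | ⟨i, j, hP, ⟨h1, h2⟩ | ⟨h1, h2⟩⟩ |
      ⟨i, j, hP, hP', ⟨h1, h2⟩ | ⟨h1, h2⟩⟩)
    · exact Or.inl h1
    · exact Or.inr ⟨i, j, by simpa using h1, by simpa using h2, eA i j hP⟩
    · exact Or.inr ⟨j, i, by simpa using h1, by simpa using h2, (eA i j hP).symm⟩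
    · exact Or.inr ⟨-i, -j, by simpa using h1, by simpa using h2, eB i j hP⟩
    · exact Or.inr ⟨-j, -i, by simpa using h1, by simpa using h2, (eB i j hP).symm⟩
    · exact Or.inr ⟨i, -j, by simpa using h1, by simpa using h2, e0 i j hP hP'⟩
    · exact Or.inr ⟨-j, i, by simpa using h1, by simpa using h2, (e0 i j hP hP').symm⟩

end Sides

/-! ### Identification of `|G|` and conclusion -/

section Assembly

variable {V : Type*} {G HA HB : SimpleGraph V} {w : V} {xA xB : ℕ → V}

theorem floor_ceil_mem_Icc (M N : ℕ) {t : ℝ} (ht : t ∈ Icc (-(M : ℝ)) N) :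
    ((⌊t⌋ : ℤ) : ℝ) ∈ Icc (-(M : ℝ)) N ∧ ((⌈t⌉ : ℤ) : ℝ) ∈ Icc (-(M : ℝ)) N := by
  have h1 : -(M : ℤ) ≤ ⌊t⌋ := Int.le_floor.2 (by push_cast; exact ht.1)
  have h2 : ⌈t⌉ ≤ (N : ℤ) := Int.ceil_le.2 (by push_cast; exact ht.2)
  have h1' : -(M : ℝ) ≤ ⌊t⌋ := by exact_mod_cast h1
  have h2' : (⌈t⌉ : ℝ) ≤ N := by exact_mod_cast h2
  exact ⟨⟨h1', (Int.floor_le t).trans ht.2⟩, ⟨ht.1.trans (Int.le_ceil t), h2'⟩⟩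

theorem floor_ceil_mem_Ici (M : ℕ) {t : ℝ} (ht : t ∈ Ici (-(M : ℝ))) :
    ((⌊t⌋ : ℤ) : ℝ) ∈ Ici (-(M : ℝ)) ∧ ((⌈t⌉ : ℤ) : ℝ) ∈ Ici (-(M : ℝ)) := by
  have h1 : -(M : ℤ) ≤ ⌊t⌋ := Int.le_floor.2 (by push_cast; exact ht)
  have h1' : -(M : ℝ) ≤ ⌊t⌋ := by exact_mod_cast h1
  exact ⟨h1', (mem_Ici.1 ht).trans (Int.le_ceil t)⟩

theorem natCast_mem_Icc_iff (M N i : ℕ) : (i : ℝ) ∈ Icc (-(M : ℝ)) N ↔ i ∈ Iic N := by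
  simp only [mem_Icc, mem_Iic, Nat.cast_le, and_iff_right_iff_imp]
  intro _
  have h1 : (0 : ℝ) ≤ M := M.cast_nonneg
  have h2 : (0 : ℝ) ≤ i := i.cast_nonneg
  linarith

theorem neg_natCast_mem_Icc_iff (M N i : ℕ) : -(i : ℝ) ∈ Icc (-(M : ℝ)) N ↔ i ∈ Iic M := by
  simp only [mem_Icc, mem_Iic, neg_le_neg_iff, Nat.cast_le, and_iff_left_iff_imp]
  intro _
  have h1 : (0 : ℝ) ≤ N := N.cast_nonneg
  have h2 : (0 : ℝ) ≤ i := i.cast_nonneg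
  linarith

theorem natCast_mem_Ici_iff (M i : ℕ) : (i : ℝ) ∈ Ici (-(M : ℝ)) ↔ i ∈ (univ : Set ℕ) := by
  simp only [mem_Ici, mem_univ, iff_true]
  have h1 : (0 : ℝ) ≤ M := M.cast_nonneg
  have h2 : (0 : ℝ) ≤ i := i.cast_nonneg
  linarith

theorem neg_natCast_mem_Ici_iff (M i : ℕ) : -(i : ℝ) ∈ Ici (-(M : ℝ)) ↔ i ∈ Iic M := by
  simp

theorem exists_pair_eq_and {m M : ℕ} {p : ℕ → ℕ → Prop} :
    (∃ i j, (i = m ∧ j = M) ∧ p i j) ↔ p m M := by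
  aesop

theorem exists_pair_eq_and_and {a l N m M : ℕ} {p : ℕ → ℕ → Prop} :
    (∃ i j, (a = l ∧ i = N) ∧ (a = m ∧ j = M) ∧ p i j) ↔ (a = l ∧ a = m) ∧ p N M := by
  aesop

/-- A finite side and a finite side. -/
theorem IsSplit.exists_isQuotientMap_Icc (h : IsSplit G HA HB w)
    (hiso : ∀ v : V, ∃ u, G.Adj v u) {M N : ℕ} {PA PB : ℕ → ℕ → Prop}
    (hA : IsSide HA xA (Iic N) PA) (hB : IsSide HB xB (Iic M) PB) (hA0 : xA 0 = w)
    (hB0 : xB 0 = w) :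
    ∃ φ : Icc (-(M : ℝ)) N → Complex G, IsQuotientMap φ ∧
      ∀ s t, φ s = φ t ↔ SplitRel PA PB s t :=
  h.exists_isQuotientMap hiso hA hB hA0 hB0 isClosed_Icc
    (fun _ ht => (floor_ceil_mem_Icc M N ht).1) (fun _ ht => (floor_ceil_mem_Icc M N ht).2)
    ordConnected_Icc (natCast_mem_Icc_iff M N) (neg_natCast_mem_Icc_iff M N)

/-- An infinite side and a finite side. -/
theorem IsSplit.exists_isQuotientMap_Ici (h : IsSplit G HA HB w)
    (hiso : ∀ v : V, ∃ u, G.Adj v u) {M : ℕ} {PA PB : ℕ → ℕ → Prop}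
    (hA : IsSide HA xA univ PA) (hB : IsSide HB xB (Iic M) PB) (hA0 : xA 0 = w)
    (hB0 : xB 0 = w) :
    ∃ φ : Ici (-(M : ℝ)) → Complex G, IsQuotientMap φ ∧
      ∀ s t, φ s = φ t ↔ SplitRel PA PB s t :=
  h.exists_isQuotientMap hiso hA hB hA0 hB0 isClosed_Ici
    (fun _ ht => (floor_ceil_mem_Ici M ht).1) (fun _ ht => (floor_ceil_mem_Ici M ht).2)
    ordConnected_Ici (natCast_mem_Ici_iff M) (neg_natCast_mem_Ici_iff M)

theorem IsSplit.homeomorph_arc (h : IsSplit G HA HB w) (hiso : ∀ v : V, ∃ u, G.Adj v u)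
    {M N : ℕ} (hA : IsPathSeq HA xA N) (hB : IsPathSeq HB xB M) (hA0 : xA 0 = w)
    (hB0 : xB 0 = w) (hN : 0 < N) : Nonempty (Complex G ≃ₜ unitInterval) := by
  obtain ⟨φ, hφ, hker⟩ := h.exists_isQuotientMap_Icc hiso hA.isSide hB.isSide hA0 hB0
  obtain ⟨e⟩ := nonempty_homeomorph_of_isQuotientMap hφ IsQuotientMap.id
    (fun s t => (hker s t).trans (by simp [SplitRel, Subtype.ext_iff]))
  have hlt : -(M : ℝ) < N := by
    have h1 : (0 : ℝ) ≤ M := M.cast_nonneg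
    have h2 : (0 : ℝ) < N := Nat.cast_pos.2 hN
    linarith
  exact ⟨e.trans (iccHomeoI _ _ hlt)⟩

theorem IsSplit.homeomorph_ray (h : IsSplit G HA HB w) (hiso : ∀ v : V, ∃ u, G.Adj v u)
    {M : ℕ} (hA : IsRaySeq HA xA) (hB : IsPathSeq HB xB M) (hA0 : xA 0 = w)
    (hB0 : xB 0 = w) : Nonempty (Complex G ≃ₜ Ici (0 : ℝ)) := by
  obtain ⟨φ, hφ, hker⟩ := h.exists_isQuotientMap_Ici hiso hA.isSide hB.isSide hA0 hB0
  obtain ⟨e⟩ := nonempty_homeomorph_of_isQuotientMap hφ IsQuotientMap.id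
    (fun s t => (hker s t).trans (by simp [SplitRel, Subtype.ext_iff]))
  exact ⟨e.trans ((Homeomorph.addRight (M : ℝ)).subtype fun t => by
    simp [← neg_le_iff_add_nonneg])⟩

theorem IsSplit.homeomorph_line (h : IsSplit G HA HB w) (hiso : ∀ v : V, ∃ u, G.Adj v u)
    (hA : IsRaySeq HA xA) (hB : IsRaySeq HB xB) (hA0 : xA 0 = w)
    (hB0 : xB 0 = w) : Nonempty (Complex G ≃ₜ ℝ) := by
  obtain ⟨φ, hφ, hker⟩ := h.exists_isQuotientMap hiso hA.isSide hB.isSide hA0 hB0 (K := univ)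
    isClosed_univ (fun _ _ => trivial) (fun _ _ => trivial) ordConnected_univ (by simp) (by simp)
  obtain ⟨e⟩ := nonempty_homeomorph_of_isQuotientMap hφ IsQuotientMap.id
    (fun s t => (hker s t).trans (by simp [SplitRel, Subtype.ext_iff]))
  exact ⟨e.trans (Homeomorph.Set.univ ℝ)⟩

/-- The cycle occupies `[-M, -m]`; its stem and the path together form `[-m, N]`, nondegenerate as
`0 < N`. -/
theorem IsSplit.homeomorph_lollipop (h : IsSplit G HA HB w) (hiso : ∀ v : V, ∃ u, G.Adj v u)
    {m M N : ℕ} (hA : IsPathSeq HA xA N) (hB : IsLassoSeq HB xB m M) (hA0 : xA 0 = w)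
    (hB0 : xB 0 = w) (hN : 0 < N) : Nonempty (Complex G ≃ₜ lollipop) := by
  obtain ⟨φ, hφ, hker⟩ := h.exists_isQuotientMap_Icc hiso hA.isSide hB.isSide hA0 hB0
  have hab : -(M : ℝ) < -m := neg_lt_neg (by exact_mod_cast (by have := hB.lt; omega : m < M))
  have hbc : -(m : ℝ) < N := by
    have h1 : (0 : ℝ) ≤ m := m.cast_nonneg
    have h2 : (0 : ℝ) < N := Nat.cast_pos.2 hN
    linarith
  obtain ⟨g, hg⟩ := exists_isGluing_lollipop hab hbc
  obtain ⟨q, hq, hqker⟩ := hg.exists_isQuotientMap_of_compact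
  refine nonempty_homeomorph_of_isQuotientMap hφ hq fun s t => ?_
  rw [hker, hqker]
  simp only [SplitRel, false_and, exists_false, false_or, or_false, exists_pair_eq_and]
  tauto

theorem IsSplit.homeomorph_openLollipop (h : IsSplit G HA HB w)
    (hiso : ∀ v : V, ∃ u, G.Adj v u) {m M : ℕ} (hA : IsRaySeq HA xA) (hB : IsLassoSeq HB xB m M)
    (hA0 : xA 0 = w) (hB0 : xB 0 = w) : Nonempty (Complex G ≃ₜ openLollipop) := by
  obtain ⟨φ, hφ, hker⟩ := h.exists_isQuotientMap_Ici hiso hA.isSide hB.isSide hA0 hB0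
  have hab : -(M : ℝ) < -m := neg_lt_neg (by exact_mod_cast (by have := hB.lt; omega : m < M))
  obtain ⟨q, hq, hqker⟩ := exists_isQuotientMap_openLollipop hab
  refine nonempty_homeomorph_of_isQuotientMap hφ hq fun s t => ?_
  rw [hker, hqker]
  simp only [SplitRel, false_and, exists_false, false_or, or_false, exists_pair_eq_and]
  tauto

/-- The two stems join to a bar of length `l + m`. If that is `0`, both cycles pass through `w`. -/
theorem IsSplit.homeomorph_dumbbell_or_figureEight (h : IsSplit G HA HB w)
    (hiso : ∀ v : V, ∃ u, G.Adj v u) {m M l N : ℕ} (hA : IsLassoSeq HA xA l N)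
    (hB : IsLassoSeq HB xB m M) (hA0 : xA 0 = w) (hB0 : xB 0 = w) :
    Nonempty (Complex G ≃ₜ dumbbell) ∨ Nonempty (Complex G ≃ₜ figureEight) := by
  obtain ⟨φ, hφ, hker⟩ := h.exists_isQuotientMap_Icc hiso hA.isSide hB.isSide hA0 hB0
  have hab : -(M : ℝ) < -m := neg_lt_neg (by exact_mod_cast (by have := hB.lt; omega : m < M))
  have hcd : (l : ℝ) < N := by exact_mod_cast (by have := hA.lt; omega : l < N)
  rcases Nat.eq_zero_or_pos (l + m) with h0 | h0
  · right
    obtain ⟨rfl, rfl⟩ : l = 0 ∧ m = 0 := by omega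
    simp only [Nat.cast_zero, neg_zero] at hab hcd
    obtain ⟨g, hg⟩ := exists_isGluing_figureEight hab hcd
    obtain ⟨q, hq, hqker⟩ := hg.exists_isQuotientMap_of_compact
    refine nonempty_homeomorph_of_isQuotientMap hφ hq fun s t => ?_
    rw [hker, hqker]
    simp only [SplitRel, exists_pair_eq_and, true_and,
      Nat.cast_zero, neg_zero]
    grind
  · left
    have hbc : -(m : ℝ) < l := by
      have : (0 : ℝ) < l + m := by exact_mod_cast h0
      linarith
    obtain ⟨g, hg⟩ := exists_isGluing_dumbbell hab hbc hcd
    obtain ⟨q, hq, hqker⟩ := hg.exists_isQuotientMap_of_compact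
    refine nonempty_homeomorph_of_isQuotientMap hφ hq fun s t => ?_
    rw [hker, hqker]
    have hno : ¬ (0 = l ∧ 0 = m) := by omega
    simp only [SplitRel, exists_pair_eq_and, exists_pair_eq_and_and, hno, false_and, or_false]
    tauto

/-- `X` is an arc, a ray, a double ray, a lollipop with or without its endpoint, a dumbbell or a
figure-of-eight. -/
def IsListed (X : Type*) [TopologicalSpace X] : Prop :=
  Nonempty (X ≃ₜ unitInterval) ∨ Nonempty (X ≃ₜ Set.Ici (0 : ℝ)) ∨ Nonempty (X ≃ₜ ℝ) ∨
    Nonempty (X ≃ₜ lollipop) ∨ Nonempty (X ≃ₜ openLollipop) ∨ Nonempty (X ≃ₜ dumbbell) ∨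
      Nonempty (X ≃ₜ figureEight)

theorem IsPathSeq.pos {H : SimpleGraph V} {x : ℕ → V} {N : ℕ} (h : IsPathSeq H x N)
    (hne : H.edgeSet.Nonempty) : 0 < N := by
  obtain ⟨e, he⟩ := hne
  obtain ⟨i, hi, -⟩ := h.edge e he
  omega

theorem IsSplit.isListed (h : IsSplit G HA HB w) (hiso : ∀ v : V, ∃ u, G.Adj v u)
    (hneA : HA.edgeSet.Nonempty) (hneB : HB.edgeSet.Nonempty)
    (hA : FourEdgeRho HA w) (hB : FourEdgeRho HB w) : IsListed (Complex G) := by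
  obtain ⟨xA, hA0, hA | ⟨N, hA⟩ | ⟨l, N, hA⟩⟩ := hA.classify <;>
    obtain ⟨xB, hB0, hB | ⟨M, hB⟩ | ⟨m, M, hB⟩⟩ := hB.classify <;> unfold IsListed
  · have := h.homeomorph_line hiso hA hB hA0 hB0
    tauto
  · have := h.homeomorph_ray hiso hA hB hA0 hB0
    tauto
  · have := h.homeomorph_openLollipop hiso hA hB hA0 hB0
    tauto
  · have := h.symm.homeomorph_ray hiso hB hA hB0 hA0
    tauto
  · have := h.homeomorph_arc hiso hA hB hA0 hB0 (hA.pos hneA)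
    tauto
  · have := h.homeomorph_lollipop hiso hA hB hA0 hB0 (hA.pos hneA)
    tauto
  · have := h.symm.homeomorph_openLollipop hiso hB hA hB0 hA0
    tauto
  · have := h.symm.homeomorph_lollipop hiso hB hA hB0 hA0 (hB.pos hneB)
    tauto
  · have := h.homeomorph_dumbbell_or_figureEight hiso hA hB hA0 hB0
    tauto

/-- Treated as a degenerate split whose second side has no edges. -/
theorem homeomorph_arc_of_two_vertices (hiso : ∀ v : V, ∃ u, G.Adj v u) {u v : V}
    (huv : ∀ z, z = u ∨ z = v) : Nonempty (Complex G ≃ₜ unitInterval) := by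
  have hadj : G.Adj u v := by
    obtain ⟨z, hz⟩ := hiso u
    rcases huv z with rfl | rfl
    · exact absurd rfl hz.ne
    · exact hz
  have hsplit : IsSplit G G ⊥ u := ⟨by simp, by simp⟩
  have hA : IsPathSeq G (fun i => if i = 0 then u else v) 1 := by
    refine ⟨fun i hi => ?_, fun i j hi hj hij => ?_, fun e he => ⟨0, one_pos, ?_⟩⟩
    · obtain rfl : i = 0 := by omega
      simpa using hadj
    · obtain rfl | rfl : i = 0 ∨ i = 1 := by omega
      all_goals obtain rfl | rfl : j = 0 ∨ j = 1 := by omega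
      all_goals simp [hadj.ne, hadj.ne'] at hij ⊢
    · induction e with
      | _ a b =>
        have hab : G.Adj a b := he
        rcases huv a with rfl | rfl <;> rcases huv b with rfl | rfl
        · exact absurd rfl hab.ne
        · simp
        · simp
        · exact absurd rfl hab.ne
  have hB : IsPathSeq (⊥ : SimpleGraph V) (fun _ => u) 0 :=
    ⟨by omega, by omega, by simp⟩
  exact hsplit.homeomorph_arc hiso hA hB (by simp) rfl one_pos

theorem isListed_of_isArcConnected (hG : ¬ CyclicallyConnected G)
    (h5 : IsArcConnected 5 (Complex G)) : IsListed (Complex G) := by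
  have hpre : G.Preconnected := preconnected_of_isArcConnected (by omega) h5
  -- With at most one vertex, `G` would be vacuously cyclically connected.
  have hnt : Nontrivial V := by
    by_contra hc
    rw [not_nontrivial_iff_subsingleton] at hc
    exact hG fun u v huv => absurd (Subsingleton.elim u v) huv
  have hiso : ∀ v : V, ∃ u, G.Adj v u := fun v => hpre.exists_adj_of_nontrivial v
  by_cases h3 : ∀ u v : V, ∃ z, z ≠ u ∧ z ≠ v
  · have hcut : ∃ w a b : V, a ≠ w ∧ b ≠ w ∧ ∀ p : G.Walk a b, w ∈ p.support := by
      by_contra! hc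
      exact hG (cyclicallyConnected_of_no_cut hpre h3 hc)
    obtain ⟨w, a, b, ha, hb, hab⟩ := hcut
    obtain ⟨HA, HB, hs, hneA, hneB⟩ := exists_split hpre ha hb hab
    have hF := fun F hF hn => exists_innerPath_of_isArcConnected h5 hiso F hF hn
    exact hs.isListed hiso hneA hneB (hs.fourEdgeRho hF hneB.some_mem)
      (hs.symm.fourEdgeRho hF hneA.some_mem)
  · push Not at h3
    obtain ⟨u, v, huv⟩ := h3
    exact Or.inl (homeomorph_arc_of_two_vertices hiso fun z => or_iff_not_imp_left.2 (huv z))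

/-- Each circle is cut open at its base point by dropping an end of the parameter interval; the base
point is still reached at the other parameter identified with that end. -/
theorem IsListed.isArcConnected {X : Type*} [TopologicalSpace X] (h : IsListed X) (n : ℕ) :
    IsArcConnected n X := by
  rcases h with h | h | h | h | h | h | h
  all_goals obtain ⟨e⟩ := h
  · exact isArcConnected_of_homeomorph e (J := Icc 0 1) ordConnected_Icc
      (left_mem_Icc.2 zero_le_one) (right_mem_Icc.2 zero_le_one) one_pos continuous_id
      Function.bijective_id n
  · exact isArcConnected_of_homeomorph e (J := Ici 0) ordConnected_Ici
      (a := 0) (b := 1) (by simp) (by simp) one_pos continuous_id Function.bijective_id n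
  · exact isArcConnected_of_homeomorph e (J := univ) ordConnected_univ
      (a := 0) (b := 1) trivial trivial one_pos continuous_subtype_val
      (Homeomorph.Set.univ ℝ).bijective n
  · obtain ⟨g, hg⟩ := exists_isGluing_lollipop zero_lt_one one_lt_two
    refine hg.isArcConnected e (J := Ioc 0 2) ordConnected_Ioc Ioc_subset_Icc_self
      (a := 1) (b := 2) (by norm_num) (by norm_num) one_lt_two ?_ ?_ n
    · rintro s ⟨hs, -⟩ t ⟨ht, -⟩ (h | ⟨h, -⟩ | ⟨-, h⟩)
      · exact h
      · exact absurd h hs.ne'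
      · exact absurd h ht.ne'
    · rintro s ⟨hs, hs'⟩
      rcases hs.eq_or_lt with rfl | hs
      · exact ⟨1, by norm_num, by simp⟩
      · exact ⟨s, ⟨hs, hs'⟩, Or.inl rfl⟩
  · obtain ⟨g, hg, -⟩ := exists_isGluing_openLollipop zero_lt_one
    refine hg.isArcConnected e (J := Ioi 0) ordConnected_Ioi Ioi_subset_Ici_self
      (a := 1) (b := 2) (by simp) (by simp) one_lt_two ?_ ?_ n
    · rintro s hs t ht (h | ⟨h, -⟩ | ⟨-, h⟩)
      · exact h
      · exact absurd h (mem_Ioi.1 hs).ne'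
      · exact absurd h (mem_Ioi.1 ht).ne'
    · intro s hs
      rcases (mem_Ici.1 hs).eq_or_lt with rfl | hs
      · exact ⟨1, by simp, by simp⟩
      · exact ⟨s, hs, Or.inl rfl⟩
  · obtain ⟨g, hg⟩ := exists_isGluing_dumbbell zero_lt_one one_lt_two (by norm_num : (2 : ℝ) < 3)
    refine hg.isArcConnected e (J := Ioo 0 3) ordConnected_Ioo Ioo_subset_Icc_self
      (a := 1) (b := 2) (by norm_num) (by norm_num) one_lt_two ?_ ?_ n
    · rintro s ⟨hs, hs'⟩ t ⟨ht, ht'⟩ (h | ⟨h, -⟩ | ⟨-, h⟩ | ⟨-, h⟩ | ⟨h, -⟩)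
      · exact h
      · exact absurd h hs.ne'
      · exact absurd h ht.ne'
      · exact absurd h ht'.ne
      · exact absurd h hs'.ne
    · rintro s ⟨hs, hs'⟩
      rcases hs.eq_or_lt with rfl | hs
      · exact ⟨1, by norm_num, by simp⟩
      rcases hs'.eq_or_lt with rfl | hs'
      · exact ⟨2, by norm_num, by simp⟩
      · exact ⟨s, ⟨hs, hs'⟩, Or.inl rfl⟩
  · obtain ⟨g, hg⟩ := exists_isGluing_figureEight zero_lt_one one_lt_two
    refine hg.isArcConnected e (J := Ioo 0 2) ordConnected_Ioo Ioo_subset_Icc_self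
      (a := 1 / 2) (b := 1) (by norm_num) (by norm_num) (by norm_num) ?_ ?_ n
    · rintro s ⟨hs, hs'⟩ t ⟨ht, ht'⟩ (h | ⟨h1, h2⟩)
      · exact h
      · have h1' := (h1.resolve_left hs.ne').resolve_right hs'.ne
        have h2' := (h2.resolve_left ht.ne').resolve_right ht'.ne
        exact h1'.trans h2'.symm
    · rintro s ⟨hs, hs'⟩
      rcases hs.eq_or_lt with rfl | hs
      · exact ⟨1, by norm_num, by simp⟩
      rcases hs'.eq_or_lt with rfl | hs'
      · exact ⟨1, by norm_num, by simp⟩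
      · exact ⟨s, ⟨hs, hs'⟩, Or.inl rfl⟩

end Assembly

end ArcGraph

theorem mainTheorem4 {V : Type*} (G : SimpleGraph V) (hG : ¬ ArcGraph.CyclicallyConnected G) :
    ArcGraph.IsArcConnected 5 (ArcGraph.Complex G) ↔
      Nonempty (ArcGraph.Complex G ≃ₜ unitInterval) ∨
      Nonempty (ArcGraph.Complex G ≃ₜ Set.Ici (0 : ℝ)) ∨
      Nonempty (ArcGraph.Complex G ≃ₜ ℝ) ∨
      Nonempty (ArcGraph.Complex G ≃ₜ ArcGraph.lollipop) ∨
      Nonempty (ArcGraph.Complex G ≃ₜ ArcGraph.openLollipop) ∨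
      Nonempty (ArcGraph.Complex G ≃ₜ ArcGraph.dumbbell) ∨
      Nonempty (ArcGraph.Complex G ≃ₜ ArcGraph.figureEight) :=
  ⟨fun h => ArcGraph.isListed_of_isArcConnected hG h,
    fun h => ArcGraph.IsListed.isArcConnected h 5⟩
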